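/- Let $k$ be an algebraically closed field of prime characteristic $p>0$, let $V$ be a $k$-vector space of finite dimension $d$, and let $G\subset\operatorname{GL}(V)$ be a finite subgroup whose order is not divisible by $p$ and which contains no pseudo-reflections (that is, no $g\in G$ for which $g-1$ has rank $1$ on $V$). Let $S=\operatorname{Sym}_k V$ be the symmetric algebra of $V$ with the induced action of $G$ by $k$-algebra automorphisms, and let $R=S^G$ be the invariant subring. For $e\ge 0$ let ${}^eR$ denote $R$ regarded as an $R$-module through the $e$-th iterate of the Frobenius map, i.e. $r\cdot x=r^{p^e}x$. Let $V_0=k$ (the trivial representation), $V_1,\dots,V_n$ be a complete set of pairwise non-isomorphic irreducible representations of $G$ over $k$, and let $M_i=(S\otimes_k V_i)^G$ for $i=0,\dots,n$, where $G$ acts diagonally; these are $R$-modules, and $M_0\cong R$. For every $e\ge 0$ there are uniquely determined non-negative integers $c_{0,e},\dots,c_{n,e}$ such that $${}^eR\;\cong\; M_0^{\oplus c_{0,e}}\oplus M_1^{\oplus c_{1,e}}\oplus\cdots\oplus M_n^{\oplus c_{n,e}}$$ as $R$-modules. Moreover, for every $i=0,\dots,n$ the generalized $F$-signature of $M_i$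 with respect to $R$, $$s(R,M_i):=\lim_{e\to\infty}\frac{c_{i,e}}{p^{de}},$$ exists, and $$s(R,M_i)=\frac{\dim_k V_i}{|G|}=\frac{\operatorname{rank}_R M_i}{|G|}.$$ -/

import Mathlib

open scoped TensorProduct

universe u v w

noncomputable section

/-- The `k`-algebra endomorphism of the symmetric algebra induced by a linear endomorphism. -/
def symMap {k : Type u} {V : Type v} [Field k] [AddCommGroup V] [Module k V] (f : V →ₗ[k] V) :
    SymmetricAlgebra k V →ₐ[k] SymmetricAlgebra k V :=
  SymmetricAlgebra.lift (SymmetricAlgebra.ι k V ∘ₗ f)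

theorem symMap_ι {k : Type u} {V : Type v} [Field k] [AddCommGroup V] [Module k V]
    (f : V →ₗ[k] V) (x : V) :
    symMap f (SymmetricAlgebra.ι k V x) = SymmetricAlgebra.ι k V (f x) := by
  simp [symMap]

theorem symMap_one {k : Type u} {V : Type v} [Field k] [AddCommGroup V] [Module k V] :
    symMap (1 : V →ₗ[k] V) = AlgHom.id k (SymmetricAlgebra k V) := by
  apply SymmetricAlgebra.algHom_ext
  ext x
  simp [symMap_ι]

theorem symMap_mul {k : Type u} {V : Type v} [Field k] [AddCommGroup V] [Module k V]
    (f g : V →ₗ[k] V) : symMap (f * g) = (symMap f).comp (symMap g) := by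
  apply SymmetricAlgebra.algHom_ext
  ext x
  simp [symMap_ι]

section Invariants

variable {k : Type u} {V : Type v} [Field k] [AddCommGroup V] [Module k V]
  (G : Subgroup (LinearMap.GeneralLinearGroup k V))

/-- The action of `G ⊂ GL(V)` on `S = Sym V` by `k`-algebra automorphisms, as a representation. -/
def symRep : Representation k G (SymmetricAlgebra k V) where
  toFun g := (symMap ((g : LinearMap.GeneralLinearGroup k V) : V →ₗ[k] V)).toLinearMap
  map_one' := by
    ext x
    simp [symMap_one]
  map_mul' g h := by
    ext x
    simp [symMap_mul]

/-- The action of `g` on `S` is the algebra map extending the action of `g` on `V`. -/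
theorem symRep_apply (g : G) (s : SymmetricAlgebra k V) :
    symRep G g s = symMap ((g : LinearMap.GeneralLinearGroup k V) : V →ₗ[k] V) s := rfl

/-- The invariant subring `R = S^G`. -/
def invariantRing : Subalgebra k (SymmetricAlgebra k V) where
  carrier := {s | ∀ g : G, symRep G g s = s}
  mul_mem' := by
    intro a b ha hb g
    have ha' := ha g
    have hb' := hb g
    rw [symRep_apply] at ha' hb' ⊢
    rw [map_mul, ha', hb']
  add_mem' := by
    intro a b ha hb g
    rw [map_add, ha g, hb g]
  algebraMap_mem' := by
    intro r g
    rw [symRep_apply, AlgHom.commutes]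

/-- The `R`-module `(S ⊗ W)^G` attached to a representation `W` of `G`; the group acts diagonally
and `R` acts on the left factor. -/
def covariantModule {W : Type w} [AddCommGroup W] [Module k W] (ρ : Representation k G W) :
    Submodule (invariantRing G) (SymmetricAlgebra k V ⊗[k] W) where
  carrier := {x | ∀ g : G, ((symRep G).tprod ρ) g x = x}
  zero_mem' := by
    intro g
    rw [map_zero]
  add_mem' := by
    intro a b ha hb g
    rw [map_add, ha g, hb g]
  smul_mem' := by
    intro r x hx g
    have key : ∀ y : SymmetricAlgebra k V ⊗[k] W,
        ((symRep G).tprod ρ) g (r • y) = r • ((symRep G).tprod ρ) g y := by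
      intro y
      induction y using TensorProduct.induction_on with
      | zero => simp
      | tmul s m =>
        have hr := r.2 g
        rw [symRep_apply] at hr
        rw [Subalgebra.smul_def, Subalgebra.smul_def, TensorProduct.smul_tmul',
          Representation.tprod_apply, TensorProduct.map_tmul, TensorProduct.map_tmul,
          TensorProduct.smul_tmul', smul_eq_mul, smul_eq_mul, symRep_apply, symRep_apply,
          map_mul, hr]
      | add a b ha hb => rw [smul_add, map_add, map_add, smul_add, ha, hb]
    rw [key, hx g]

instance invariantRing.instExpChar (p : ℕ) [ExpChar k p] : ExpChar (invariantRing G) p :=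
  expChar_of_injective_algebraMap (algebraMap k (invariantRing G)).injective p

/-- `G` contains no pseudo-reflections: no `g ∈ G` fixes pointwise exactly a hyperplane of `V`,
i.e. no `g - 1` has rank one. -/
def NoPseudoReflections : Prop :=
  ∀ g ∈ G, Module.finrank k (LinearMap.range ((g : V →ₗ[k] V) - 1)) ≠ 1

end Invariants

/-- The Frobenius pushforward `ᵉM` of a module `M` over a ring `A` of characteristic `p`: the same
additive group, with `a • m = a ^ (p ^ e) m`. -/
def FrobeniusPushforward (A : Type u) (_p _e : ℕ) (M : Type v) [CommRing A] [AddCommGroup M]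
    [Module A M] : Type v := M

instance FrobeniusPushforward.instAddCommGroup (A : Type u) (p e : ℕ) (M : Type v) [CommRing A]
    [AddCommGroup M] [Module A M] : AddCommGroup (FrobeniusPushforward A p e M) :=
  inferInstanceAs (AddCommGroup M)

instance FrobeniusPushforward.instModule (A : Type u) (p e : ℕ) (M : Type v) [CommRing A]
    [ExpChar A p] [AddCommGroup M] [Module A M] : Module A (FrobeniusPushforward A p e M) :=
  Module.compHom M (iterateFrobenius A p e)

theorem FrobeniusPushforward.smul_def (A : Type u) (p e : ℕ) (M : Type v) [CommRing A]
    [ExpChar A p] [AddCommGroup M] [Module A M] (a : A) (m : M) :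
    (show M from a • (show FrobeniusPushforward A p e M from m)) = a ^ p ^ e • m := rfl

/-- `(W i)` is a complete set of pairwise non-isomorphic irreducible representations of the
finite group `G` over `k`. (Every irreducible representation of a finite group is
finite-dimensional, so it has an isomorphic copy in the universe of `k`.) -/
structure IsCompleteIrreducibles {k : Type u} [Field k] {G : Type v} [Group G] {ι : Type}
    {W : ι → Type w} [∀ i, AddCommGroup (W i)] [∀ i, Module k (W i)]
    (ρ : ∀ i, Representation k G (W i)) : Prop where
  irreducible : ∀ i, (ρ i).IsIrreducible
  non_isomorphic : ∀ i j, Nonempty ((ρ i).Equiv (ρ j)) → i = j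
  complete : ∀ (U : Type u) [AddCommGroup U] [Module k U] (σ : Representation k G U),
    σ.IsIrreducible → ∃ i, Nonempty (σ.Equiv (ρ i))

/-- The numbers `c i` are the multiplicities of a decomposition
`ᵉR ≅ ⨁ i, (M i)^{⊕ c i}` of `R`-modules, with `R = S^G` and `M i = (S ⊗ W i)^G`. -/
def IsFrobeniusDecomposition {k : Type u} {V : Type v} [Field k] [AddCommGroup V] [Module k V]
    (G : Subgroup (LinearMap.GeneralLinearGroup k V)) (p : ℕ) [ExpChar k p] {n : ℕ}
    {W : Fin (n + 1) → Type w} [∀ i, AddCommGroup (W i)] [∀ i, Module k (W i)]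
    (ρ : ∀ i, Representation k G (W i)) (e : ℕ) (c : Fin (n + 1) → ℕ) : Prop :=
  Nonempty (FrobeniusPushforward (invariantRing G) p e (invariantRing G) ≃ₗ[invariantRing G]
    (∀ i, Fin (c i) → covariantModule G (ρ i)))

/-- `s` is the generalized `F`-signature `s(R, M i)`: for every `e` the multiplicities `c e` in
a decomposition of `ᵉR` exist and are uniquely determined, and `c e i / p ^ (d e)` converges to `s`,
where `d = dim V`. -/
def IsGeneralizedFSignature {k : Type u} {V : Type v} [Field k] [AddCommGroup V] [Module k V]
    (G : Subgroup (LinearMap.GeneralLinearGroup k V)) (p : ℕ) [ExpChar k p] {n : ℕ}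
    {W : Fin (n + 1) → Type w} [∀ i, AddCommGroup (W i)] [∀ i, Module k (W i)]
    (ρ : ∀ i, Representation k G (W i)) (i : Fin (n + 1)) (s : ℝ) : Prop :=
  ∃ c : ℕ → Fin (n + 1) → ℕ,
    (∀ e c', IsFrobeniusDecomposition G p ρ e c' ↔ c' = c e) ∧
    Filter.Tendsto (fun e => (c e i : ℝ) / (p : ℝ) ^ (Module.finrank k V * e))
      Filter.atTop (nhds s)

end

/-! Write q = p^e, let 𝔪^[q] ⊂ S be the ideal generated by the q-th powers of vectors, and let T_e
be the Frobenius twist of S/𝔪^[q], a representation of dimension q^d.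

Existence of a decomposition. As |G| is invertible in k, averaging gives a G-equivariant k-linear
section σ of S → S/𝔪^[q], and s ⊗ t ↦ s^q σ(t) is an equivariant S-linear isomorphism S ⊗ T_e ≅ ᵉS.
Taking invariants, ᵉR ≅ (S ⊗ T_e)^G (`nonempty_frobeniusPushforward_equiv_covariantModule`). By
Maschke T_e is a sum of copies of the V_i, so ᵉR is a sum of copies of the M_i with c_{i,e} = dim
Hom_G(V_i, T_e).

Uniqueness. Without pseudo-reflections the group elements are independent over S even modulo any
divisor (`UnramifiedInCodimOne.dvd_coeff`). Hence, as in Auslander's theorem, R-linear maps from S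
to a free S-module are combinations of group elements, and R-linear maps (S ⊗ W)^G → (S ⊗ W')^G lift
to equivariant S-linear maps S ⊗ W → S ⊗ W'. Reduction modulo the irrelevant ideal turns an
isomorphism into W ≅ W' (`NoPseudoReflections.nonempty_equiv_of_covariantModule_equiv`).

The limit. No characters are needed. Choose s ∈ S for which f = det((gh⁻¹)s) is nonzero. Weighting
by the conjugates of s gives maps between Hom_G(W, T_e) and Hom_k(W, T_e^G) in both directions, and
by Cramer's rule their kernels consist of maps into the kernel of f on T_e. If a is the lex-leading
exponent of f, that kernel has dimension at most q^d − ∏ (q − a_i) = o(q^d). Thus dim Hom_G(W, T_e)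
is dim W · dim T_e^G up to o(q^d); the case W = k[G] says q^d is |G| · dim T_e^G up to o(q^d), and
dividing gives the ratio dim W / |G|. The same determinant shows that M_i generically spans S ⊗ V_i,
whence rank M_i = dim V_i. -/

noncomputable section

open Representation Filter

/-! ### Independence of group elements over a factorial domain -/

/-- In a factorial domain, a common divisor of `t * a` and `t * b` with `a`, `b` relatively prime
divides `t`. -/
theorem IsRelPrime.dvd_of_dvd_mul_of_dvd_mul {S : Type*} [CommRing S] [IsDomain S]
    [UniqueFactorizationMonoid S] {a b t d : S} (hab : IsRelPrime a b) (ha : d ∣ t * a)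
    (hb : d ∣ t * b) : d ∣ t := by
  classical
  let := UniqueFactorizationMonoid.toGCDMonoid S
  have h1 : d ∣ gcd (t * a) (t * b) := dvd_gcd ha hb
  have h2 : Associated (gcd (t * a) (t * b)) (t * gcd a b) := gcd_mul_left' t a b
  have h3 : IsUnit (gcd a b) := hab (gcd_dvd_left a b) (gcd_dvd_right a b)
  exact (h1.trans h2.dvd).trans (by
    obtain ⟨u, hu⟩ := h3
    exact ⟨(u⁻¹ : Sˣ), by rw [← hu, mul_assoc, Units.mul_inv, mul_one]⟩)

/-- A group acting on a ring is unramified in codimension one if any two distinct group elements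
are separated by two elements whose differences are relatively prime. -/
def UnramifiedInCodimOne (G S : Type*) [Group G] [CommRing S] [MulSemiringAction G S] : Prop :=
  ∀ g h : G, g ≠ h → ∃ x y : S, IsRelPrime (g • x - h • x) (g • y - h • y)

/-- A version of Dedekind's independence of characters modulo a divisor. -/
theorem UnramifiedInCodimOne.dvd_coeff {G S : Type*} [Group G] [CommRing S] [IsDomain S]
    [UniqueFactorizationMonoid S] [MulSemiringAction G S] (hG : UnramifiedInCodimOne G S)
    (d : S) (F : Finset G) : ∀ t : G → S, (∀ s : S, d ∣ ∑ g ∈ F, t g * g • s) →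
      ∀ g ∈ F, d ∣ t g := by
  classical
  induction F using Finset.induction_on with
  | empty => simp
  | insert h F hF ih =>
    intro t ht
    have key : ∀ x : S, ∀ g ∈ F, d ∣ t g * (g • x - h • x) := by
      intro x
      apply ih
      intro s
      -- Dedekind's trick: the relation at `x * s` minus `h • x` times the relation at `s` has no
      -- `h` term, leaving a shorter relation with coefficients `t g * (g • x - h • x)`.
      have h1 := dvd_sub (ht (x * s)) ((ht s).mul_left (h • x))
      rw [Finset.sum_insert hF, Finset.sum_insert hF] at h1
      convert h1 using 1
      rw [mul_add, Finset.mul_sum, smul_mul']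
      have : ∀ a b c e : S, a = c → (a + b) - (c + e) = b - e := by intros; subst_vars; ring
      rw [this _ _ _ _ (by ring), ← Finset.sum_sub_distrib]
      refine Finset.sum_congr rfl fun g _ => ?_
      rw [smul_mul']
      ring
    have hF' : ∀ g ∈ F, d ∣ t g := by
      intro g hg
      obtain ⟨x, y, hxy⟩ := hG g h (by rintro rfl; exact hF hg)
      exact hxy.dvd_of_dvd_mul_of_dvd_mul (key x g hg) (key y g hg)
    intro g hg
    rcases Finset.mem_insert.mp hg with rfl | hg
    -- Once all other coefficients are divisible by `d`, the relation at `s = 1` handles the last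
    -- one.
    · have h1 := ht 1
      rw [Finset.sum_insert hF] at h1
      have h2 : d ∣ ∑ x ∈ F, t x * x • (1 : S) :=
        Finset.dvd_sum fun x hx => (hF' x hx).mul_right _
      simpa using (dvd_add_left h2).mp h1
    · exact hF' g hg

theorem UnramifiedInCodimOne.coeff_eq_zero {G S : Type*} [Group G] [CommRing S] [IsDomain S]
    [UniqueFactorizationMonoid S] [MulSemiringAction G S] (hG : UnramifiedInCodimOne G S)
    [Fintype G] (t : G → S) (ht : ∀ s : S, ∑ g, t g * g • s = 0) (g : G) : t g = 0 :=
  zero_dvd_iff.mp (hG.dvd_coeff 0 Finset.univ t (fun s => by rw [ht s]) g (Finset.mem_univ _))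

/-- The matrix `(g h⁻¹ s)` attached to an element `s`. -/
def orbitMatrix (G : Type*) {S : Type*} [Group G] [CommRing S] [MulSemiringAction G S] (s : S) :
    Matrix G G S :=
  Matrix.of fun g h => (g * h⁻¹) • s

/-- An infinite subring of invariants yields an element whose conjugates form a normal basis
generically. -/
theorem exists_det_orbitMatrix_ne_zero {k G S : Type*} [Field k] [Infinite k] [Group G] [Fintype G]
    [DecidableEq G] [CommRing S] [IsDomain S] [Algebra k S] [MulSemiringAction G S]
    [SMulCommClass G k S] (v : S) (hv : ∀ g : G, g ≠ 1 → g • v ≠ v) :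
    ∃ s : S, (orbitMatrix G s).det ≠ 0 := by
  classical
  -- At `X = v` every `P g` with `g ≠ 1` vanishes, because the factor indexed by `l = 1` occurs in
  -- it. So `M` specializes to a nonzero scalar matrix at `v`, and its determinant is a nonzero
  -- polynomial.
  open Polynomial in
  let P : G → S[X] := fun g => ∏ l ∈ Finset.univ.erase g, (X - C (l • v))
  let M : Matrix G G S[X] := Matrix.of fun g h => P (g * h⁻¹)
  have hne : ∀ g ∈ Finset.univ.erase (1 : G), v - g • v ≠ 0 := fun g hg =>
    sub_ne_zero.mpr (hv g (Finset.ne_of_mem_erase hg)).symm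
  have hPv : ∀ g, (P g).eval v = if g = 1 then ∏ l ∈ Finset.univ.erase (1 : G), (v - l • v)
      else 0 := by
    intro g
    split_ifs with h
    · subst h; simp [P, Polynomial.eval_prod]
    · simp only [P, Polynomial.eval_prod]
      exact Finset.prod_eq_zero (i := 1) (by simp [Ne.symm h]) (by simp)
  have hM : M.det ≠ 0 := by
    intro h0
    have h1 : (Polynomial.evalRingHom v) M.det = 0 := by rw [h0, map_zero]
    rw [RingHom.map_det] at h1
    have h2 : (Polynomial.evalRingHom v).mapMatrix M =
        Matrix.diagonal fun _ => ∏ l ∈ Finset.univ.erase (1 : G), (v - l • v) := by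
      ext g h
      simp only [RingHom.mapMatrix_apply, Matrix.map_apply, M, Matrix.of_apply,
        Polynomial.coe_evalRingHom, hPv, Matrix.diagonal_apply, mul_inv_eq_one]
    rw [h2, Matrix.det_diagonal] at h1
    simp only [Finset.prod_const] at h1
    exact pow_ne_zero _ (Finset.prod_ne_zero_iff.mpr hne) h1
  -- The specialization point has to be a scalar: it is fixed by `G`, so the conjugate of `P 1` at
  -- `c` under `g` is `P g` at `c`, and `M` at `c` is an orbit matrix.
  obtain ⟨c, hc⟩ : ∃ c : k, M.det.eval (algebraMap k S c) ≠ 0 := by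
    by_contra! h
    refine hM (Polynomial.eq_zero_of_infinite_isRoot _ ?_)
    refine (Set.infinite_range_of_injective (algebraMap k S).injective).mono ?_
    rintro _ ⟨c, rfl⟩
    exact h c
  refine ⟨(P 1).eval (algebraMap k S c), ?_⟩
  convert hc using 1
  rw [← Polynomial.coe_evalRingHom, RingHom.map_det]
  congr 1
  ext g h
  simp only [orbitMatrix, Matrix.of_apply, RingHom.mapMatrix_apply, Matrix.map_apply, M, P,
    Polynomial.coe_evalRingHom, Polynomial.eval_prod, Finset.smul_prod', Polynomial.eval_sub,
    Polynomial.eval_X, Polynomial.eval_C, smul_sub, smul_algebraMap, smul_smul]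
  refine Finset.prod_bij (fun l _ => g * h⁻¹ * l) ?_ ?_ ?_ ?_
  · intro l hl
    simpa using Finset.ne_of_mem_erase hl
  · intro a _ b _ hab
    simpa using hab
  · intro b hb
    refine ⟨(g * h⁻¹)⁻¹ * b, ?_, by group⟩
    have := Finset.ne_of_mem_erase hb
    refine Finset.mem_erase.mpr ⟨?_, Finset.mem_univ _⟩
    rw [Ne, inv_mul_eq_one]
    exact this.symm
  · intro l _
    rfl

/-- Cramer's rule for a square system with coefficients in a ring and unknowns in a module. -/
theorem Matrix.det_smul_eq_zero_of_sum_smul_eq_zero {n S T : Type*} [Fintype n] [DecidableEq n]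
    [CommRing S] [AddCommGroup T] [Module S T] (N : Matrix n n S) (x : n → T)
    (h : ∀ i, ∑ j, N i j • x j = 0) (j : n) : N.det • x j = 0 := by
  have h1 : ∑ i, N.adjugate j i • ∑ l, N i l • x l = 0 := by simp [h]
  simp only [Finset.smul_sum, smul_smul] at h1
  rw [Finset.sum_comm] at h1
  simp only [← Finset.sum_smul, ← Matrix.mul_apply, Matrix.adjugate_mul, Matrix.smul_apply,
    Matrix.one_apply, smul_eq_mul, mul_ite, mul_one, mul_zero, ite_smul, zero_smul] at h1
  simpa using h1

/-- Elements dual to the orbit of `s`. -/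
theorem exists_dual_orbit {G S : Type*} [Group G] [Fintype G]
    [DecidableEq G] [CommRing S] [MulSemiringAction G S] (s : S) :
    ∃ y : G → S, ∀ g : G, ∑ h, ((g * h⁻¹) • s) * y h =
      if g = 1 then (orbitMatrix G s).det else 0 := by
  refine ⟨fun h => (orbitMatrix G s).adjugate h 1, fun g => ?_⟩
  have := congrFun (congrFun (Matrix.mul_adjugate (orbitMatrix G s)) g) 1
  rw [Matrix.mul_apply] at this
  simpa [orbitMatrix, Matrix.one_apply] using this

/-- Every map from `S` to a free module that is linear over the invariants is a combination of the
group elements. -/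
theorem UnramifiedInCodimOne.exists_eq_sum_smul {G S Y ι : Type*} [Group G] [Fintype G]
    [CommRing S] [IsDomain S] [UniqueFactorizationMonoid S] [MulSemiringAction G S]
    (hG : UnramifiedInCodimOne G S) [AddCommGroup Y] [Module S Y] [Finite ι]
    (b : Module.Basis ι S Y) {s : S} [DecidableEq G] (hs : (orbitMatrix G s).det ≠ 0)
    (f : S →+ Y) (hf : ∀ r x : S, (∀ g : G, g • r = r) → f (r * x) = r • f x) :
    ∃ w : G → Y, ∀ x, f x = ∑ g, (g • x) • w g := by
  classical
  have := Fintype.ofFinite ι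
  obtain ⟨y, hy⟩ := exists_dual_orbit (G := G) s
  set d := (orbitMatrix G s).det with hd
  have htr : ∀ (x : S) (l : G), l • ∑ g : G, g • x = ∑ g : G, g • x := by
    intro x l
    rw [Finset.smul_sum]
    simp only [smul_smul]
    exact Fintype.sum_equiv (Equiv.mulLeft l) _ _ fun _ => rfl
  -- Up to the factor `d`, the conjugates of `s` generate `S` over the invariants, with coefficients
  -- the traces of `y h * x`. Applying `f` then exhibits `f (d * x)` as a combination of group
  -- elements.
  have hdx : ∀ x, d * x = ∑ h : G, (∑ g : G, g • (y h * x)) * (h⁻¹ • s) := by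
    intro x
    simp only [Finset.sum_mul]
    rw [Finset.sum_comm]
    have : ∀ g : G, ∑ h : G, g • (y h * x) * h⁻¹ • s =
        if g = 1 then d * x else 0 := by
      intro g
      have h1 := congrArg (fun z => g • z * g • x) (hy g⁻¹)
      simp only [Finset.smul_sum, Finset.sum_mul, smul_mul', smul_smul, mul_inv_cancel_left,
        inv_eq_one] at h1 ⊢
      trans (g • if g = 1 then d else 0) * g • x
      · rw [← h1]
        exact Finset.sum_congr rfl fun h _ => by ring
      · split_ifs with h
        · subst h; simp
        · simp
    rw [Finset.sum_congr rfl fun g _ => this g]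
    simp
  have hfd : ∀ x, f (d * x) = ∑ h : G, (∑ g : G, g • (y h * x)) • f (h⁻¹ • s) := by
    intro x
    rw [hdx, map_sum]
    exact Finset.sum_congr rfl fun h _ => hf _ _ (htr _)
  -- The norm of `d` is an invariant multiple of `d`, so it can be pulled out of `f`.
  set r := ∏ g : G, g • d with hr
  have hrd : r = d * ∏ g ∈ Finset.univ.erase (1 : G), g • d := by
    rw [hr, ← Finset.mul_prod_erase _ _ (Finset.mem_univ (1 : G)), one_smul]
  set d' := ∏ g ∈ Finset.univ.erase (1 : G), g • d
  have hrinv : ∀ l : G, l • r = r := by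
    intro l
    rw [hr, Finset.smul_prod']
    simp only [smul_smul]
    exact Fintype.prod_equiv (Equiv.mulLeft l) _ _ fun _ => rfl
  have hr0 : r ≠ 0 := Finset.prod_ne_zero_iff.mpr fun g _ => (smul_ne_zero_iff_ne g).mpr hs
  let t : G → Y := fun g => ∑ h : G, (g • (y h * d')) • f (h⁻¹ • s)
  have hrf : ∀ x, r • f x = ∑ g, (g • x) • t g := by
    intro x
    rw [← hf r x hrinv, hrd, mul_assoc, hfd]
    simp only [t, Finset.sum_smul, Finset.smul_sum]
    rw [Finset.sum_comm]
    refine Finset.sum_congr rfl fun g _ => Finset.sum_congr rfl fun h _ => ?_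
    rw [smul_smul, ← smul_mul']
    congr 2
    ring
  -- The denominator `r` is removed here: the combination takes values in `r • Y`, so independence
  -- modulo `r` makes each coefficient divisible by `r`.
  have hdvd : ∀ g i, r ∣ b.repr (t g) i := by
    intro g i
    refine hG.dvd_coeff r Finset.univ (fun g => b.repr (t g) i) (fun x => ?_) g (Finset.mem_univ _)
    refine ⟨b.repr (f x) i, ?_⟩
    have h1 := congrArg (fun z => b.repr z i) (hrf x)
    simp only [map_smul, map_sum, Finsupp.smul_apply, Finsupp.finsetSum_apply,
      smul_eq_mul] at h1
    rw [h1]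
    exact Finset.sum_congr rfl fun _ _ => mul_comm _ _
  choose c hc using hdvd
  refine ⟨fun g => ∑ i, c g i • b i, fun x => ?_⟩
  have ht : ∀ g, t g = r • ∑ i, c g i • b i := by
    intro g
    rw [← b.sum_repr (t g), Finset.smul_sum]
    exact Finset.sum_congr rfl fun i _ => by rw [hc, smul_smul]
  have : Module.IsTorsionFree S Y := .of_smul_eq_zero fun a y hay => by
    by_contra! hne
    refine hne.2 (b.ext_elem fun i => ?_)
    have h1 := congrArg (fun z => b.repr z i) hay
    simpa [hne.1] using h1
  have h2 := hrf x
  simp only [ht] at h2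
  refine smul_right_injective Y hr0 ?_
  simp only [h2, Finset.smul_sum]
  refine Finset.sum_congr rfl fun g _ => Finset.sum_congr rfl fun i _ => ?_
  rw [smul_comm]

/-- Coordinatewise this is independence modulo the divisor `0`. It gives the uniqueness of
coefficients on which all later identities between lifts rest. -/
theorem UnramifiedInCodimOne.smul_coeff_injective {G S Y ι : Type*} [Group G] [Fintype G]
    [CommRing S] [IsDomain S] [UniqueFactorizationMonoid S] [MulSemiringAction G S]
    (hG : UnramifiedInCodimOne G S) [AddCommGroup Y] [Module S Y]
    (b : Module.Basis ι S Y) {w w' : G → Y}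
    (h : ∀ x : S, ∑ g, (g • x) • w g = ∑ g, (g • x) • w' g) : w = w' := by
  funext g
  refine b.ext_elem fun i => sub_eq_zero.mp ?_
  refine hG.coeff_eq_zero (fun g => b.repr (w g) i - b.repr (w' g) i) (fun x => ?_) g
  have h1 := congrArg (fun z => b.repr z i) (h x)
  simp only [map_smul, map_sum, Finsupp.smul_apply, Finsupp.finsetSum_apply, smul_eq_mul] at h1
  simp only [sub_mul, Finset.sum_sub_distrib, sub_eq_zero]
  simpa only [mul_comm] using h1

/-- A map that is linear over the invariants with invariant values is a twisted trace
`x ↦ ∑ g, g (x w)`. -/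
theorem UnramifiedInCodimOne.existsUnique_eq_trace {k G S Y ι : Type*} [Field k] [Group G]
    [Fintype G]
    [CommRing S] [IsDomain S] [UniqueFactorizationMonoid S] [MulSemiringAction G S]
    (hG : UnramifiedInCodimOne G S) [AddCommGroup Y] [Module S Y] [Finite ι]
    (b : Module.Basis ι S Y) {s : S} [DecidableEq G] (hs : (orbitMatrix G s).det ≠ 0)
    [Module k Y] (τ : Representation k G Y)
    (hτ : ∀ (g : G) (x : S) (y : Y), τ g (x • y) = (g • x) • τ g y)
    (f : S →+ Y) (hf : ∀ r x : S, (∀ g : G, g • r = r) → f (r * x) = r • f x)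
    (hinv : ∀ g x, τ g (f x) = f x) :
    ∃! w : Y, ∀ x, f x = ∑ g, τ g (x • w) := by
  obtain ⟨w, hw⟩ := hG.exists_eq_sum_smul b hs f hf
  -- Invariance of the values of `f` together with uniqueness of coefficients makes `w` equivariant,
  -- so it is determined by `w 1`.
  have h1 : ∀ h : G, (fun g => τ h (w (h⁻¹ * g))) = w := by
    intro h
    refine hG.smul_coeff_injective b fun x => ?_
    rw [← hw x, ← hinv h x, hw x, map_sum]
    simp only [hτ, smul_smul]
    refine (Fintype.sum_equiv (Equiv.mulLeft h) _ _ fun g => ?_).symm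
    simp
  refine ⟨w 1, fun x => ?_, fun w' hw' => ?_⟩
  · rw [hw]
    refine Finset.sum_congr rfl fun g _ => ?_
    have := congrFun (h1 g) g
    simp only [inv_mul_cancel] at this
    rw [hτ, this]
  · have h2 : (fun g => τ g w') = w := hG.smul_coeff_injective b fun x => by
      rw [← hw x, hw' x]
      simp only [hτ]
    simpa using congrFun h2 1

/-! ### The action on the symmetric algebra -/

section SymAction

variable {k : Type u} {V : Type v} [Field k] [AddCommGroup V] [Module k V]
  (G : Subgroup (LinearMap.GeneralLinearGroup k V))

/-- The action of `G ⊂ GL(V)` on `Sym V` by ring automorphisms. -/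
instance symAction : MulSemiringAction G (SymmetricAlgebra k V) where
  smul g s := symRep G g s
  one_smul s := by
    change symRep G 1 s = s
    rw [map_one, Module.End.one_apply]
  mul_smul g h s := by
    change symRep G (g * h) s = symRep G g (symRep G h s)
    rw [map_mul, Module.End.mul_apply]
  smul_zero g := map_zero (symRep G g)
  smul_add g := map_add (symRep G g)
  smul_one g := map_one (symMap _)
  smul_mul g := map_mul (symMap _)

theorem symAction_smul_def (g : G) (s : SymmetricAlgebra k V) : g • s = symRep G g s := rfl

theorem symAction_smul_ι (g : G) (x : V) : g • SymmetricAlgebra.ι k V x =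
    SymmetricAlgebra.ι k V (((g : LinearMap.GeneralLinearGroup k V) : V →ₗ[k] V) x) :=
  symMap_ι _ x

instance symAction.instSMulCommClass : SMulCommClass G k (SymmetricAlgebra k V) where
  smul_comm g a s := map_smul (symRep G g) a s

theorem mem_invariantRing {s : SymmetricAlgebra k V} :
    s ∈ invariantRing G ↔ ∀ g : G, g • s = s := Iff.rfl

theorem mem_covariantModule {W : Type w} [AddCommGroup W] [Module k W]
    {ρ : Representation k G W} {x : SymmetricAlgebra k V ⊗[k] W} :
    x ∈ covariantModule G ρ ↔ ∀ g : G, ((symRep G).tprod ρ) g x = x := Iff.rfl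

/-- A shortcut for instance search. -/
abbrev covariantModule.addCommGroupShortcut {W : Type w} [AddCommGroup W] [Module k W]
    (ρ : Representation k G W) : AddCommGroup (covariantModule G ρ) :=
  Submodule.addCommGroup _

/-- A shortcut for instance search. -/
abbrev covariantModule.moduleShortcut {W : Type w} [AddCommGroup W] [Module k W]
    (ρ : Representation k G W) : Module (invariantRing G) (covariantModule G ρ) :=
  Submodule.module _

/-- A shortcut for instance search. -/
abbrev covariantModule.smulShortcut {W : Type w} [AddCommGroup W] [Module k W]
    (ρ : Representation k G W) : SMul (invariantRing G) (covariantModule G ρ) :=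
  (Submodule.module (covariantModule G ρ)).toSMul

theorem symRep_tprod_smul {W : Type w} [AddCommGroup W] [Module k W]
    (ρ : Representation k G W) (g : G) (s : SymmetricAlgebra k V)
    (y : SymmetricAlgebra k V ⊗[k] W) :
    (symRep G).tprod ρ g (s • y) = (g • s) • (symRep G).tprod ρ g y := by
  induction y using TensorProduct.induction_on with
  | zero => simp
  | tmul t m =>
    simp only [TensorProduct.smul_tmul', smul_eq_mul, Representation.tprod_apply,
      TensorProduct.map_tmul, ← symAction_smul_def, smul_mul']
  | add a b ha hb => simp only [smul_add, map_add, ha, hb]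

instance SymmetricAlgebra.instUniqueFactorizationMonoid [FiniteDimensional k V] :
    UniqueFactorizationMonoid (SymmetricAlgebra k V) :=
  (SymmetricAlgebra.equivMvPolynomial
    (Module.finBasis k V)).symm.toMulEquiv.uniqueFactorizationMonoid inferInstance

end SymAction

/-! ### Coprime linear forms and absence of pseudo-reflections -/

/-- Polynomials of total degree one that are linearly independent are relatively prime. -/
theorem MvPolynomial.isRelPrime_of_isHomogeneous_one {k ι : Type*} [Field k]
    {f g : MvPolynomial ι k} (hf : f.IsHomogeneous 1) (hg : g.IsHomogeneous 1)
    (h : LinearIndependent k ![f, g]) : IsRelPrime f g := by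
  have hf0 : f ≠ 0 := h.ne_zero 0
  have hg0 : g ≠ 0 := h.ne_zero 1
  rintro c ⟨a, rfl⟩ ⟨b, rfl⟩
  have hc0 : c ≠ 0 := left_ne_zero_of_mul hf0
  have ha0 : a ≠ 0 := right_ne_zero_of_mul hf0
  have hb0 : b ≠ 0 := right_ne_zero_of_mul hg0
  have h1 := hf.totalDegree hf0
  have h2 := hg.totalDegree hg0
  rw [totalDegree_mul_of_isDomain hc0 ha0] at h1
  rw [totalDegree_mul_of_isDomain hc0 hb0] at h2
  rcases Nat.eq_zero_or_pos c.totalDegree with hc | hc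
  · rw [totalDegree_eq_zero_iff_eq_C] at hc
    rw [hc]
    refine IsUnit.map C (isUnit_iff_ne_zero.mpr fun h0 => hc0 ?_)
    rw [hc, h0, C_0]
  · have ha := totalDegree_eq_zero_iff_eq_C.mp (show a.totalDegree = 0 by omega)
    have hb := totalDegree_eq_zero_iff_eq_C.mp (show b.totalDegree = 0 by omega)
    exfalso
    rw [LinearIndependent.pair_iff] at h
    have := h (coeff 0 b) (-coeff 0 a) (by
      rw [MvPolynomial.smul_eq_C_mul, MvPolynomial.smul_eq_C_mul, map_neg, ← ha, ← hb]
      ring)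
    apply hb0
    rw [hb, this.1, C_0]

theorem SymmetricAlgebra.isHomogeneous_equivMvPolynomial_ι {k V κ : Type*} [Field k]
    [AddCommGroup V] [Module k V] (b : Module.Basis κ k V) (x : V) :
    (SymmetricAlgebra.equivMvPolynomial b (SymmetricAlgebra.ι k V x)).IsHomogeneous 1 := by
  have h : (⊤ : Submodule k V) ≤ (MvPolynomial.homogeneousSubmodule κ k 1).comap
      ((SymmetricAlgebra.equivMvPolynomial b).toLinearMap ∘ₗ SymmetricAlgebra.ι k V) := by
    rw [← b.span_eq, Submodule.span_le]
    rintro _ ⟨i, rfl⟩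
    simpa using MvPolynomial.isHomogeneous_X k i
  exact h (Submodule.mem_top (x := x))

theorem SymmetricAlgebra.coeff_equivMvPolynomial_ι {k V κ : Type*} [Field k]
    [AddCommGroup V] [Module k V] (b : Module.Basis κ k V) (x : V) (i : κ) :
    (SymmetricAlgebra.equivMvPolynomial b (SymmetricAlgebra.ι k V x)).coeff (Finsupp.single i 1) =
      b.repr x i := by
  classical
  have h : MvPolynomial.lcoeff k (Finsupp.single i 1) ∘ₗ
      (SymmetricAlgebra.equivMvPolynomial b).toLinearMap ∘ₗ SymmetricAlgebra.ι k V =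
      b.coord i := by
    refine b.ext fun j => ?_
    simp [MvPolynomial.coeff_X, Finsupp.single_apply, Finsupp.single_left_inj]
  exact LinearMap.congr_fun h x

theorem SymmetricAlgebra.ι_injective {k V : Type*} [Field k] [AddCommGroup V] [Module k V] :
    Function.Injective (SymmetricAlgebra.ι k V) := by
  intro x y h
  let b := Module.Basis.ofVectorSpace k V
  refine b.ext_elem fun i => ?_
  rw [← coeff_equivMvPolynomial_ι, ← coeff_equivMvPolynomial_ι, h]

theorem SymmetricAlgebra.isRelPrime_ι {k V : Type*} [Field k]
    [AddCommGroup V] [Module k V] {x y : V} (h : LinearIndependent k ![x, y]) :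
    IsRelPrime (SymmetricAlgebra.ι k V x) (SymmetricAlgebra.ι k V y) := by
  let b := Module.Basis.ofVectorSpace k V
  let φ := SymmetricAlgebra.equivMvPolynomial b
  have h1 : LinearIndependent k ![φ (SymmetricAlgebra.ι k V x), φ (SymmetricAlgebra.ι k V y)] := by
    have := h.map' (φ.toLinearMap ∘ₗ SymmetricAlgebra.ι k V) (LinearMap.ker_eq_bot.mpr
      (φ.injective.comp SymmetricAlgebra.ι_injective))
    rwa [show (φ.toLinearMap ∘ₗ SymmetricAlgebra.ι k V) ∘ ![x, y] =
      ![φ (SymmetricAlgebra.ι k V x), φ (SymmetricAlgebra.ι k V y)] by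
        ext1 i; fin_cases i <;> rfl] at this
  have h2 := MvPolynomial.isRelPrime_of_isHomogeneous_one
    (isHomogeneous_equivMvPolynomial_ι b x) (isHomogeneous_equivMvPolynomial_ι b y) h1
  intro c hcx hcy
  have := h2 (map_dvd φ hcx) (map_dvd φ hcy)
  exact (MulEquiv.isUnit_map φ).mp this

section SymAction

variable {k : Type u} {V : Type v} [Field k] [AddCommGroup V] [Module k V]
  (G : Subgroup (LinearMap.GeneralLinearGroup k V))

/-- On `V` one has g − h = h(h⁻¹g − 1). Its rank is not 0, since g ≠ h, and not 1, since h⁻¹g is no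
pseudo-reflection. Two independent vectors in its image are coprime linear forms. -/
theorem NoPseudoReflections.unramifiedInCodimOne [FiniteDimensional k V]
    (hG : NoPseudoReflections G) : UnramifiedInCodimOne G (SymmetricAlgebra k V) := by
  intro g h hgh
  let D : V →ₗ[k] V := ((g : LinearMap.GeneralLinearGroup k V) : V →ₗ[k] V) -
    ((h : LinearMap.GeneralLinearGroup k V) : V →ₗ[k] V)
  let E : V →ₗ[k] V := (((h⁻¹ * g : G) : LinearMap.GeneralLinearGroup k V) : V →ₗ[k] V) - 1
  have hDE : D = ((h : LinearMap.GeneralLinearGroup k V) : V →ₗ[k] V) * E := by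
    simp only [D, E, mul_sub, mul_one]
    rw [← Units.val_mul]
    simp
  have hfr : Module.finrank k (LinearMap.range D) = Module.finrank k (LinearMap.range E) := by
    rw [hDE, Module.End.mul_eq_comp, LinearMap.range_comp]
    exact (Submodule.equivMapOfInjective _ ((LinearMap.GeneralLinearGroup.toLinearEquiv
      (h : LinearMap.GeneralLinearGroup k V)).injective) _).finrank_eq.symm
  have h1 : Module.finrank k (LinearMap.range E) ≠ 1 := hG _ (h⁻¹ * g).2
  have h0 : Module.finrank k (LinearMap.range D) ≠ 0 := by
    intro h0
    rw [Submodule.finrank_eq_zero, LinearMap.range_eq_bot, sub_eq_zero] at h0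
    exact hgh (Subtype.ext (Units.ext h0))
  have h2 : 2 ≤ Module.finrank k (LinearMap.range D) := by omega
  let z := Module.finBasis k (LinearMap.range D) ∘ Fin.castLE h2
  have hz : LinearIndependent k z :=
    (Module.finBasis k (LinearMap.range D)).linearIndependent.comp _ (Fin.castLE_injective h2)
  obtain ⟨x, hx⟩ := (z 0).2
  obtain ⟨y, hy⟩ := (z 1).2
  refine ⟨SymmetricAlgebra.ι k V x, SymmetricAlgebra.ι k V y, ?_⟩
  simp only [symAction_smul_ι, ← map_sub]
  refine SymmetricAlgebra.isRelPrime_ι ?_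
  have := hz.map' (LinearMap.range D).subtype (Submodule.ker_subtype _)
  rwa [show (LinearMap.range D).subtype ∘ z = ![D x, D y] by
    ext1 i
    fin_cases i
    · exact hx.symm
    · exact hy.symm] at this

/-- The fixed spaces of the nontrivial elements are finitely many proper subspaces, which cannot
cover `V` over an infinite field. -/
theorem exists_forall_smul_ι_ne [Infinite k] [Finite G] :
    ∃ v : SymmetricAlgebra k V, ∀ g : G, g ≠ 1 → g • v ≠ v := by
  classical
  have := Fintype.ofFinite G
  let F : Finset (Subspace k V) := (Finset.univ.erase (1 : G)).image fun g : G =>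
    LinearMap.ker (((g : LinearMap.GeneralLinearGroup k V) : V →ₗ[k] V) - 1)
  have hF : ⊤ ∉ F := by
    intro h
    obtain ⟨g, hg, h⟩ := Finset.mem_image.mp h
    rw [LinearMap.ker_eq_top, sub_eq_zero] at h
    exact Finset.ne_of_mem_erase hg (Subtype.ext (Units.ext h))
  have hne := Subspace.biUnion_ne_univ_of_top_notMem hF
  obtain ⟨x, hx⟩ := (Set.ne_univ_iff_exists_notMem _).mp hne
  refine ⟨SymmetricAlgebra.ι k V x, fun g hg h => hx ?_⟩
  rw [symAction_smul_ι] at h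
  have h := SymmetricAlgebra.ι_injective h
  simp only [Set.mem_iUnion]
  refine ⟨_, Finset.mem_image_of_mem _ (Finset.mem_erase.mpr ⟨hg, Finset.mem_univ _⟩), ?_⟩
  simp [h]

theorem exists_symmetricAlgebra_det_orbitMatrix_ne_zero [Infinite k] [Fintype G] [DecidableEq G] :
    ∃ s : SymmetricAlgebra k V, (orbitMatrix G s).det ≠ 0 := by
  obtain ⟨v, hv⟩ := exists_forall_smul_ι_ne G
  exact exists_det_orbitMatrix_ne_zero (k := k) v hv

end SymAction

/-! ### Lifting maps between modules of covariants -/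

section Transfer

attribute [local instance] covariantModule.addCommGroupShortcut covariantModule.moduleShortcut
  covariantModule.smulShortcut

variable {k : Type u} {V : Type v} [Field k] [AddCommGroup V] [Module k V]
  (G : Subgroup (LinearMap.GeneralLinearGroup k V))
  {W : Type*} [AddCommGroup W] [Module k W] (ρ : Representation k G W)
  {W' : Type*} [AddCommGroup W'] [Module k W'] (σ : Representation k G W')

theorem covariantTrace_mem [Fintype G] (y : SymmetricAlgebra k V ⊗[k] W) :
    ∑ g, (symRep G).tprod ρ g y ∈ covariantModule G ρ := by
  intro l
  rw [map_sum]
  refine Fintype.sum_equiv (Equiv.mulLeft l) _ _ fun g => ?_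
  rw [Equiv.coe_mulLeft, map_mul, Module.End.mul_apply]

/-- The trace `S ⊗ W → (S ⊗ W)^G`. -/
def covariantTrace [Fintype G] :
    SymmetricAlgebra k V ⊗[k] W →ₗ[invariantRing G] covariantModule G ρ where
  toFun y := ⟨∑ g, (symRep G).tprod ρ g y, covariantTrace_mem G ρ y⟩
  map_add' x y := Subtype.ext (by simp [Finset.sum_add_distrib])
  map_smul' r x := Subtype.ext (by
    simp only [RingHom.id_apply, Submodule.coe_smul, Finset.smul_sum]
    refine Finset.sum_congr rfl fun g _ => ?_
    rw [Subalgebra.smul_def, symRep_tprod_smul, (mem_invariantRing G).mp r.2 g,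
      Subalgebra.smul_def])

theorem coe_covariantTrace [Fintype G] (y : SymmetricAlgebra k V ⊗[k] W) :
    (covariantTrace G ρ y : SymmetricAlgebra k V ⊗[k] W) = ∑ g, (symRep G).tprod ρ g y := rfl

theorem covariantTrace_smul_apply [Fintype G] (g : G) (s : SymmetricAlgebra k V)
    (y : SymmetricAlgebra k V ⊗[k] W) :
    covariantTrace G ρ (s • (symRep G).tprod ρ g y) = covariantTrace G ρ ((g⁻¹ • s) • y) := by
  refine Subtype.ext ?_
  rw [coe_covariantTrace, coe_covariantTrace]
  refine Fintype.sum_equiv (Equiv.mulRight g) _ _ fun l => ?_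
  simp only [Equiv.coe_mulRight, symRep_tprod_smul, map_mul, Module.End.mul_apply, smul_smul,
    mul_inv_cancel, mul_one]

variable {G}

/-- Nondegeneracy of the trace: Tr(s y) = Σ g(s) g(y), and independence of the group elements
recovers the coefficient y at g = 1. -/
theorem covariantTrace_ext [Infinite k] [FiniteDimensional k V] [Fintype G]
    (hG : NoPseudoReflections G) {y z : SymmetricAlgebra k V ⊗[k] W}
    (h : ∀ s : SymmetricAlgebra k V, covariantTrace G ρ (s • y) = covariantTrace G ρ (s • z)) :
    y = z := by
  have hS := hG.unramifiedInCodimOne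
  have := hS.smul_coeff_injective
    (Algebra.TensorProduct.basis (SymmetricAlgebra k V) (Module.Basis.ofVectorSpace k W))
    (w := fun g => (symRep G).tprod ρ g y) (w' := fun g => (symRep G).tprod ρ g z) fun s => by
      have := congrArg Subtype.val (h s)
      simpa only [coe_covariantTrace, symRep_tprod_smul] using this
  simpa using congrFun this 1

/-- Linear maps between modules of covariants come from equivariant linear maps. -/
theorem exists_lift_of_covariantModule_hom [Infinite k] [FiniteDimensional k V] [Fintype G]
    (hG : NoPseudoReflections G) [FiniteDimensional k W']
    (Φ : covariantModule G ρ →ₗ[invariantRing G] covariantModule G σ) :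
    ∃ θ : SymmetricAlgebra k V ⊗[k] W →ₗ[SymmetricAlgebra k V] SymmetricAlgebra k V ⊗[k] W',
      (∀ y, Φ (covariantTrace G ρ y) = covariantTrace G σ (θ y)) ∧
      ∀ g y, θ ((symRep G).tprod ρ g y) = (symRep G).tprod σ g (θ y) := by
  classical
  obtain ⟨s, hs⟩ := exists_symmetricAlgebra_det_orbitMatrix_ne_zero G
  have hS := hG.unramifiedInCodimOne
  -- For fixed `y` the map x ↦ Φ(Tr(x y)) is linear over the invariants with invariant values, hence
  -- equals x ↦ Tr(x z). Uniqueness of `z` then makes y ↦ z both `S`-linear and equivariant.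
  have key : ∀ y, ∃ z, ∀ x : SymmetricAlgebra k V,
      Φ (covariantTrace G ρ (x • y)) = covariantTrace G σ (x • z) := by
    intro y
    let f : SymmetricAlgebra k V →+ SymmetricAlgebra k V ⊗[k] W' :=
      { toFun := fun x => Φ (covariantTrace G ρ (x • y))
        map_zero' := by simp
        map_add' := fun a b => by simp [add_smul] }
    obtain ⟨z, hz, -⟩ := hS.existsUnique_eq_trace
      (Algebra.TensorProduct.basis (SymmetricAlgebra k V) (Module.finBasis k W')) hs
      ((symRep G).tprod σ) (symRep_tprod_smul G σ) f
      (fun r x hr => by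
        have : (r * x) • y = (⟨r, hr⟩ : invariantRing G) • (x • y) := by
          rw [Subalgebra.smul_def, smul_smul]
        simp only [f, AddMonoidHom.coe_mk, ZeroHom.coe_mk]
        rw [this, (covariantTrace G ρ).map_smul, Φ.map_smul]
        rfl)
      (fun g x => (Φ (covariantTrace G ρ (x • y))).2 g)
    exact ⟨z, fun x => Subtype.ext (hz x)⟩
  choose θ hθ using key
  refine ⟨{ toFun := θ, map_add' := fun a b => ?_, map_smul' := fun t y => ?_ },
    fun y => ?_, fun g y => ?_⟩
  · refine covariantTrace_ext σ hG fun x => ?_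
    rw [← hθ, smul_add, smul_add, map_add, map_add, map_add, hθ, hθ]
  · refine covariantTrace_ext σ hG fun x => ?_
    rw [← hθ, RingHom.id_apply, smul_smul, smul_smul, hθ]
  · have := hθ y 1
    rwa [one_smul, one_smul] at this
  · refine covariantTrace_ext σ hG fun x => ?_
    exact (hθ _ x).symm.trans ((congrArg Φ (covariantTrace_smul_apply G ρ g x y)).trans
      ((hθ y _).trans (covariantTrace_smul_apply G σ g x (θ y)).symm))

/-- The augmentation of the symmetric algebra. -/
def symAug (k : Type u) (V : Type v) [Field k] [AddCommGroup V] [Module k V] :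
    SymmetricAlgebra k V →ₐ[k] k :=
  SymmetricAlgebra.lift 0

theorem symAug_smul (g : G) (s : SymmetricAlgebra k V) : symAug k V (g • s) = symAug k V s := by
  have : (symAug k V).comp (symMap ((g : LinearMap.GeneralLinearGroup k V) : V →ₗ[k] V)) =
      symAug k V := by
    apply SymmetricAlgebra.algHom_ext
    ext x
    simp [symAug, symMap_ι]
  exact AlgHom.congr_fun this s

/-- Reduction of `S ⊗ W` modulo the irrelevant ideal. -/
def tensorAug (k : Type u) (V : Type v) [Field k] [AddCommGroup V] [Module k V] (W : Type*)
    [AddCommGroup W] [Module k W] : SymmetricAlgebra k V ⊗[k] W →ₗ[k] W :=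
  TensorProduct.lid k W ∘ₗ (symAug k V).toLinearMap.rTensor W

theorem tensorAug_tmul (s : SymmetricAlgebra k V) (x : W) :
    tensorAug k V W (s ⊗ₜ x) = symAug k V s • x := by
  simp [tensorAug]

theorem tensorAug_smul (s : SymmetricAlgebra k V) (y : SymmetricAlgebra k V ⊗[k] W) :
    tensorAug k V W (s • y) = symAug k V s • tensorAug k V W y := by
  induction y using TensorProduct.induction_on with
  | zero => simp
  | tmul t m => simp [TensorProduct.smul_tmul', tensorAug_tmul, mul_smul]
  | add a b ha hb => simp only [smul_add, map_add, ha, hb]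

theorem tensorAug_tprod (g : G) (y : SymmetricAlgebra k V ⊗[k] W) :
    tensorAug k V W ((symRep G).tprod ρ g y) = ρ g (tensorAug k V W y) := by
  induction y using TensorProduct.induction_on with
  | zero => simp
  | tmul t m =>
    rw [Representation.tprod_apply, TensorProduct.map_tmul, tensorAug_tmul, tensorAug_tmul,
      ← symAction_smul_def, symAug_smul, map_smul]
  | add a b ha hb => simp only [map_add, ha, hb]

/-- An `S`-linear map descends modulo the irrelevant ideal, so `y` may be replaced by its constant
part. This makes reduction compatible with composition. -/
theorem tensorAug_map_eq
    (θ : SymmetricAlgebra k V ⊗[k] W →ₗ[SymmetricAlgebra k V] SymmetricAlgebra k V ⊗[k] W')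
    (y : SymmetricAlgebra k V ⊗[k] W) :
    tensorAug k V W' (θ y) = tensorAug k V W' (θ (1 ⊗ₜ tensorAug k V W y)) := by
  induction y using TensorProduct.induction_on with
  | zero => simp
  | tmul t m =>
    have h1 : (t ⊗ₜ m : SymmetricAlgebra k V ⊗[k] W) = t • (1 ⊗ₜ m) := by
      simp [TensorProduct.smul_tmul']
    have h2 : ∀ a : k, (1 ⊗ₜ (a • m) : SymmetricAlgebra k V ⊗[k] W) =
        (algebraMap k (SymmetricAlgebra k V) a) • (1 ⊗ₜ m) := by
      intro a
      rw [TensorProduct.tmul_smul, algebraMap_smul]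
    rw [tensorAug_tmul, h2, h1, θ.map_smul, θ.map_smul, tensorAug_smul, tensorAug_smul,
      AlgHom.commutes, Algebra.algebraMap_self_apply]
  | add a b ha hb => simp only [map_add, TensorProduct.tmul_add, ha, hb]

/-- The module of covariants determines the representation. -/
theorem NoPseudoReflections.nonempty_equiv_of_covariantModule_equiv [Infinite k]
    [FiniteDimensional k V] [Finite G] (hG : NoPseudoReflections G) [FiniteDimensional k W]
    [FiniteDimensional k W']
    (Φ : covariantModule G ρ ≃ₗ[invariantRing G] covariantModule G σ) :
    Nonempty (ρ.Equiv σ) := by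
  have := Fintype.ofFinite G
  obtain ⟨θ, hθ, hθg⟩ := exists_lift_of_covariantModule_hom ρ σ hG Φ.toLinearMap
  obtain ⟨η, hη, -⟩ := exists_lift_of_covariantModule_hom σ ρ hG Φ.symm.toLinearMap
  have h1 : ∀ y, η (θ y) = y := fun y => covariantTrace_ext ρ hG fun s => by
    rw [← map_smul, ← map_smul, ← hη, ← hθ]
    exact Φ.symm_apply_apply _
  have h2 : ∀ y, θ (η y) = y := fun y => covariantTrace_ext σ hG fun s => by
    rw [← map_smul, ← map_smul, ← hθ, ← hη]
    exact Φ.apply_symm_apply _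
  -- Reductions of the mutually inverse lifts modulo the irrelevant ideal; they are mutually inverse
  -- and inherit equivariance.
  let a : W →ₗ[k] W' := tensorAug k V W' ∘ₗ θ.restrictScalars k ∘ₗ
    TensorProduct.mk k (SymmetricAlgebra k V) W 1
  let b : W' →ₗ[k] W := tensorAug k V W ∘ₗ η.restrictScalars k ∘ₗ
    TensorProduct.mk k (SymmetricAlgebra k V) W' 1
  have hba : ∀ x, b (a x) = x := by
    intro x
    change tensorAug k V W (η (1 ⊗ₜ tensorAug k V W' (θ (1 ⊗ₜ x)))) = x
    rw [← tensorAug_map_eq, h1, tensorAug_tmul, map_one, one_smul]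
  have hab : ∀ x, a (b x) = x := by
    intro x
    change tensorAug k V W' (θ (1 ⊗ₜ tensorAug k V W (η (1 ⊗ₜ x)))) = x
    rw [← tensorAug_map_eq, h2, tensorAug_tmul, map_one, one_smul]
  refine ⟨Representation.Equiv.mk (LinearEquiv.ofLinearMap a b (LinearMap.ext hab)
    (LinearMap.ext hba)) fun g => LinearMap.ext fun x => ?_⟩
  change tensorAug k V W' (θ (1 ⊗ₜ ρ g x)) = σ g (tensorAug k V W' (θ (1 ⊗ₜ x)))
  rw [← tensorAug_tprod, ← hθg, Representation.tprod_apply, TensorProduct.map_tmul,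
    ← symAction_smul_def, smul_one]

end Transfer

/-! ### The rank of a module of covariants -/

section Rank

attribute [local instance] covariantModule.addCommGroupShortcut covariantModule.moduleShortcut
  covariantModule.smulShortcut

variable {k : Type u} {V : Type v} [Field k] [AddCommGroup V] [Module k V]
  {G : Subgroup (LinearMap.GeneralLinearGroup k V)}
  {W : Type*} [AddCommGroup W] [Module k W] (ρ : Representation k G W)

/-- The trace `S → S^G`. -/
def invariantTrace (G : Subgroup (LinearMap.GeneralLinearGroup k V)) [Fintype G]
    (s : SymmetricAlgebra k V) : invariantRing G :=
  ⟨∑ g : G, g • s, fun l => by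
    rw [← symAction_smul_def, Finset.smul_sum]
    simp only [smul_smul]
    exact Fintype.sum_equiv (Equiv.mulLeft l) _ _ fun _ => rfl⟩

theorem covariantTrace_smul_of_mem [Fintype G] (s : SymmetricAlgebra k V)
    (m : covariantModule G ρ) : covariantTrace G ρ (s • (m : SymmetricAlgebra k V ⊗[k] W)) =
      invariantTrace G s • m := by
  refine Subtype.ext ?_
  rw [coe_covariantTrace, Submodule.coe_smul, Subalgebra.smul_def, invariantTrace,
    Finset.sum_smul]
  refine Finset.sum_congr rfl fun g _ => ?_
  rw [symRep_tprod_smul, (mem_covariantModule G).mp m.2 g]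

theorem eq_zero_of_forall_invariantTrace [Infinite k] [FiniteDimensional k V] [Fintype G]
    (hG : NoPseudoReflections G) {s : SymmetricAlgebra k V}
    (h : ∀ t : SymmetricAlgebra k V, invariantTrace G (t * s) = 0) : s = 0 := by
  have := hG.unramifiedInCodimOne.coeff_eq_zero (fun g => g • s) (fun t => by
    have := congrArg Subtype.val (h t)
    simpa only [invariantTrace, smul_mul', mul_comm, ZeroMemClass.coe_zero] using this) 1
  simpa using this

/-- Multiplying a relation Σ c_i m_i = 0 by t and taking traces gives Σ Tr(t c_i) m_i = 0 over the
invariants. So Tr(t c_i) = 0 for all t, which forces c_i = 0. -/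
theorem linearIndependent_coe_covariantModule [Infinite k] [FiniteDimensional k V] [Fintype G]
    (hG : NoPseudoReflections G) {ι : Type*} [Fintype ι] {m : ι → covariantModule G ρ}
    (hm : LinearIndependent (invariantRing G) m) :
    LinearIndependent (SymmetricAlgebra k V)
      (fun i => (m i : SymmetricAlgebra k V ⊗[k] W)) := by
  have hm := Fintype.linearIndependent_iff.mp hm
  rw [Fintype.linearIndependent_iff]
  intro c hc i
  refine eq_zero_of_forall_invariantTrace hG fun t => ?_
  refine hm (fun i => invariantTrace G (t * c i)) ?_ i
  have h1 := congrArg (fun y => covariantTrace G ρ (t • y)) hc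
  simp only [Finset.smul_sum, smul_smul, map_sum, smul_zero, map_zero] at h1
  rw [← h1]
  exact Finset.sum_congr rfl fun j _ => (covariantTrace_smul_of_mem ρ _ _).symm

/-- Upper bound: independent covariants remain independent over `S`, and S ⊗ W is free of rank dim
W. Lower bound: the covariants span the generic fibre of S ⊗ W. -/
theorem finrank_covariantModule [Infinite k] [FiniteDimensional k V] [Finite G]
    (hG : NoPseudoReflections G) [FiniteDimensional k W] :
    Module.finrank (invariantRing G) (covariantModule G ρ) = Module.finrank k W := by
  classical
  have := Fintype.ofFinite G
  refine Module.finrank_eq_of_rank_eq (le_antisymm (rank_le fun s hs => ?_) ?_)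
  · have h1 := (linearIndependent_coe_covariantModule ρ hG hs).fintype_card_le_finrank
    rwa [Module.finrank_baseChange, Fintype.card_coe] at h1
  · let L := FractionRing (SymmetricAlgebra k V)
    let b : Module.Basis _ (SymmetricAlgebra k V) (SymmetricAlgebra k V ⊗[k] W) :=
      Algebra.TensorProduct.basis _ (Module.finBasis k W)
    let E : covariantModule G ρ →ₗ[invariantRing G] (Fin (Module.finrank k W) → L) :=
      { toFun := fun m i => algebraMap (SymmetricAlgebra k V) L (b.repr m i)
        map_add' := fun x y => by ext i; simp
        map_smul' := fun r x => by
          ext i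
          simp only [Submodule.coe_smul, Subalgebra.smul_def, map_smul, Finsupp.smul_apply,
            smul_eq_mul, map_mul, RingHom.id_apply, Pi.smul_apply, Algebra.smul_def]
          rfl }
    obtain ⟨s, hs⟩ := exists_symmetricAlgebra_det_orbitMatrix_ne_zero G
    obtain ⟨y, hy⟩ := exists_dual_orbit (G := G) s
    have hspan : Submodule.span L (Set.range E) = ⊤ := by
      rw [eq_top_iff, ← (Pi.basisFun L (Fin (Module.finrank k W))).span_eq, Submodule.span_le]
      rintro _ ⟨i, rfl⟩
      -- Pairing with the dual orbit isolates the identity term of the traces, so the determinant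
      -- times each basis vector lies in the `S`-span of the covariants.
      have h1 : ∑ h : G, y h • (covariantTrace G ρ ((h⁻¹ • s) • b i) :
          SymmetricAlgebra k V ⊗[k] W) =
          (orbitMatrix G s).det • b i := by
        simp only [coe_covariantTrace, Finset.smul_sum, symRep_tprod_smul, smul_smul]
        rw [Finset.sum_comm]
        simp only [← Finset.sum_smul, mul_comm (y _), hy]
        simp
      have h2 : ∑ h : G, algebraMap (SymmetricAlgebra k V) L (y h) •
          E (covariantTrace G ρ ((h⁻¹ • s) • b i)) =
          algebraMap (SymmetricAlgebra k V) L (orbitMatrix G s).det • Pi.basisFun L _ i := by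
        ext j
        have h3 := congrArg (fun z => algebraMap (SymmetricAlgebra k V) L (b.repr z j)) h1
        simp only [map_sum, map_smul, Finsupp.finsetSum_apply, Finsupp.smul_apply, smul_eq_mul,
          map_mul, b.repr_self] at h3
        simp only [Finset.sum_apply, Pi.smul_apply, smul_eq_mul, E, LinearMap.coe_mk,
          AddHom.coe_mk, h3, Pi.basisFun_apply, Finsupp.single_apply, Pi.single_apply,
          eq_comm (a := j)]
        congr 1
        split_ifs <;> simp
      have h4 : algebraMap (SymmetricAlgebra k V) L (orbitMatrix G s).det ≠ 0 := by
        simpa using hs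
      rw [← inv_smul_smul₀ h4 (Pi.basisFun L _ i), ← h2]
      refine Submodule.smul_mem _ _ (Submodule.sum_mem _ fun h _ => Submodule.smul_mem _ _ ?_)
      exact Submodule.subset_span ⟨_, rfl⟩
    -- A basis over the fraction field can be chosen among images of covariants; its preimages are
    -- independent over the invariants.
    obtain ⟨B, hB, hBs, hBi⟩ := exists_linearIndependent L (Set.range E)
    rw [hspan] at hBs
    let BB := Module.Basis.mk hBi (by rw [Subtype.range_coe, hBs])
    have hfin : Finite B := Module.Finite.finite_basis BB
    have := Fintype.ofFinite B
    have hcard : Fintype.card B = Module.finrank k W := by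
      rw [← Module.finrank_eq_card_basis BB, Module.finrank_fin_fun]
    choose m hm using fun x : B => hB x.2
    have hmi : LinearIndependent (invariantRing G) m := by
      refine LinearIndependent.of_comp E ?_
      have h5 : E ∘ m = ((↑) : B → Fin (Module.finrank k W) → L) := funext hm
      rw [h5]
      refine hBi.restrict_scalars (R := invariantRing G) ?_
      intro r r' h
      simp only [Algebra.smul_def, mul_one] at h
      exact Subtype.ext (IsFractionRing.injective (SymmetricAlgebra k V) L h)
    rw [← hcard]
    have := hmi.cardinal_lift_le_rank
    simpa using this

end Rank

/-! ### Decomposing representations into irreducibles -/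

namespace Representation

/-- The product of a family of representations. -/
def pi {k G J : Type*} {W : J → Type*} [Field k] [Group G] [∀ j, AddCommGroup (W j)]
    [∀ j, Module k (W j)] (ρ : ∀ j, Representation k G (W j)) : Representation k G (∀ j, W j) where
  toFun g := LinearMap.pi fun j => ρ j g ∘ₗ LinearMap.proj j
  map_one' := by ext x j; simp
  map_mul' g h := by ext x j; simp

@[simp]
theorem pi_apply {k G J : Type*} {W : J → Type*} [Field k] [Group G] [∀ j, AddCommGroup (W j)]
    [∀ j, Module k (W j)] (ρ : ∀ j, Representation k G (W j)) (g : G) (x : ∀ j, W j) (j : J) :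
    pi ρ g x j = ρ j g (x j) := rfl

/-- Intertwining maps into a product. -/
def IntertwiningMap.piEquiv {k G J U : Type*} {W : J → Type*} [Field k] [Group G]
    [∀ j, AddCommGroup (W j)] [∀ j, Module k (W j)] [AddCommGroup U] [Module k U]
    (σ : Representation k G U) (ρ : ∀ j, Representation k G (W j)) :
    IntertwiningMap σ (pi ρ) ≃ₗ[k] ∀ j, IntertwiningMap σ (ρ j) where
  toFun f j := ⟨LinearMap.proj j ∘ₗ f.toLinearMap, fun g => LinearMap.ext fun x =>
    congrFun (f.isIntertwining σ (pi ρ) g x) j⟩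
  map_add' _ _ := rfl
  map_smul' _ _ := rfl
  invFun f := ⟨LinearMap.pi fun j => (f j).toLinearMap, fun g => LinearMap.ext fun x =>
    funext fun j => (f j).isIntertwining σ (ρ j) g x⟩
  left_inv _ := rfl
  right_inv _ := rfl

/-- An equivalence of representations as an isomorphism of modules over the group algebra. -/
def Equiv.asModuleEquiv {k G U W : Type*} [Field k] [Group G] [AddCommGroup U] [Module k U]
    [AddCommGroup W] [Module k W] {σ : Representation k G U} {ρ : Representation k G W}
    (φ : σ.Equiv ρ) : σ.asModule ≃ₗ[MonoidAlgebra k G] ρ.asModule :=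
  LinearEquiv.ofLinearMap
    (IntertwiningMap.equivLinearMapAsModule σ ρ φ.toIntertwiningMap)
    (IntertwiningMap.equivLinearMapAsModule ρ σ φ.symm.toIntertwiningMap)
    (LinearMap.ext fun x => φ.apply_symm_apply x)
    (LinearMap.ext fun x => φ.symm_apply_apply x)

theorem IsIrreducible.of_equiv {k G U W : Type*} [Field k] [Group G] [AddCommGroup U] [Module k U]
    [AddCommGroup W] [Module k W] {σ : Representation k G U} {ρ : Representation k G W}
    (φ : σ.Equiv ρ) (h : σ.IsIrreducible) : ρ.IsIrreducible := by
  rw [irreducible_iff_isSimpleModule_asModule] at h ⊢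
  exact IsSimpleModule.congr φ.asModuleEquiv.symm

/-- Transport of a representation along a linear equivalence. -/
def transport {k G U W : Type*} [Field k] [Group G] [AddCommGroup U] [Module k U]
    [AddCommGroup W] [Module k W] (σ : Representation k G U) (e : U ≃ₗ[k] W) :
    Representation k G W where
  toFun g := e.toLinearMap ∘ₗ σ g ∘ₗ e.symm.toLinearMap
  map_one' := by ext; simp
  map_mul' g h := by ext; simp

/-- A representation is equivalent to its transport. -/
def equivTransport {k G U W : Type*} [Field k] [Group G] [AddCommGroup U] [Module k U]
    [AddCommGroup W] [Module k W] (σ : Representation k G U) (e : U ≃ₗ[k] W) :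
    σ.Equiv (σ.transport e) :=
  .mk e fun g => by ext; simp [transport]

/-- An irreducible representation of a finite group is finite-dimensional. -/
theorem IsIrreducible.finiteDimensional {k G W : Type*} [Field k] [Group G] [Finite G]
    [AddCommGroup W] [Module k W] {ρ : Representation k G W} (h : ρ.IsIrreducible) :
    FiniteDimensional k W := by
  by_cases hW : Subsingleton W
  · infer_instance
  rw [not_subsingleton_iff_nontrivial] at hW
  obtain ⟨x, hx⟩ := exists_ne (0 : W)
  let N : Subrepresentation ρ :=
    { toSubmodule := Submodule.span k (Set.range fun g => ρ g x)
      apply_mem_toSubmodule := fun g y hy => by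
        have : Submodule.span k (Set.range fun g => ρ g x) ≤
            (Submodule.span k (Set.range fun g => ρ g x)).comap (ρ g) := by
          rw [Submodule.span_le]
          rintro _ ⟨l, rfl⟩
          exact Submodule.subset_span ⟨g * l, by simp⟩
        exact this hy }
  have hN : N = ⊤ := (eq_bot_or_eq_top N).resolve_left fun h0 => hx (by
    have : x ∈ N.toSubmodule := Submodule.subset_span ⟨1, by simp⟩
    rw [h0] at this
    exact (Submodule.mem_bot k).mp this)
  have : Submodule.span k (Set.range fun g => ρ g x) = ⊤ :=
    congrArg Subrepresentation.toSubmodule hN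
  exact ⟨⟨(Set.finite_range fun g => ρ g x).toFinset, by simpa using this⟩⟩

end Representation


/-- Completeness is only postulated in the universe of `k`; finite dimensionality allows moving any
irreducible representation to a coordinate space. -/
theorem IsCompleteIrreducibles.exists_equiv {k : Type u} [Field k] {G : Type v} [Group G]
    [Finite G] {ι : Type} {W : ι → Type w} [∀ i, AddCommGroup (W i)] [∀ i, Module k (W i)]
    {ρ : ∀ i, Representation k G (W i)} (hρ : IsCompleteIrreducibles ρ) {U : Type*}
    [AddCommGroup U] [Module k U] {σ : Representation k G U} (h : σ.IsIrreducible) :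
    ∃ i, Nonempty (σ.Equiv (ρ i)) := by
  have := h.finiteDimensional
  let e := (Module.finBasis k U).equivFun
  obtain ⟨i, ⟨φ⟩⟩ := hρ.complete _ (σ.transport e) (h.of_equiv (σ.equivTransport e))
  exact ⟨i, ⟨(σ.equivTransport e).trans φ⟩⟩

theorem IsCompleteIrreducibles.finrank_intertwiningMap {k : Type u} [Field k] [IsAlgClosed k]
    {G : Type v} [Group G] [Finite G] {ι : Type} [DecidableEq ι] {W : ι → Type w}
    [∀ i, AddCommGroup (W i)] [∀ i, Module k (W i)]
    {ρ : ∀ i, Representation k G (W i)} (hρ : IsCompleteIrreducibles ρ) (i j : ι) :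
    Module.finrank k (IntertwiningMap (ρ i) (ρ j)) = if i = j then 1 else 0 := by
  have hi := hρ.irreducible i
  have hj := hρ.irreducible j
  have := hi.finiteDimensional
  split_ifs with h
  · subst h
    exact IsIrreducible.finrank_intertwiningMap_self (ρ i)
  · have : IsEmpty ((ρ i).Equiv (ρ j)) := ⟨fun φ => h (hρ.non_isomorphic i j ⟨φ⟩)⟩
    exact Module.finrank_zero_of_subsingleton

/-- No `k`-structure on `N` is given, so one is induced from the group algebra. Phrasing the
conclusion through `MonoidAlgebra.single g a` keeps it independent of that structure. -/
theorem IsCompleteIrreducibles.exists_addEquiv_of_isSimpleModule {k : Type u} [Field k]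
    {G : Type v} [Group G] [Finite G] {ι : Type} {W : ι → Type w}
    [∀ i, AddCommGroup (W i)] [∀ i, Module k (W i)]
    {ρ : ∀ i, Representation k G (W i)} (hρ : IsCompleteIrreducibles ρ) (N : Type*)
    [AddCommGroup N] [Module (MonoidAlgebra k G) N] [IsSimpleModule (MonoidAlgebra k G) N] :
    ∃ (i : ι) (f : N ≃+ W i), ∀ (g : G) (a : k) (x : N),
      f (MonoidAlgebra.single g a • x) = a • ρ i g (f x) := by
  let _ : Module k N := Module.compHom N (algebraMap k (MonoidAlgebra k G))
  have hk : ∀ (a : k) (x : N), a • x = algebraMap k (MonoidAlgebra k G) a • x := fun _ _ => rfl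
  let τ : Representation k G N :=
    { toFun := fun g =>
        { toFun := fun x => MonoidAlgebra.single g (1 : k) • x
          map_add' := smul_add _
          map_smul' := fun a x => by
            rw [RingHom.id_apply, hk, hk, smul_smul, smul_smul, Algebra.commutes] }
      map_one' := by
        ext x
        exact one_smul (MonoidAlgebra k G) x
      map_mul' := fun g h => by
        ext x
        simp [smul_smul, MonoidAlgebra.single_mul_single] }
  have hsingle : ∀ (g : G) (a : k) (x : N), MonoidAlgebra.single g a • x = a • τ g x := by
    intro g a x
    change _ = a • (MonoidAlgebra.single g (1 : k) • x)
    rw [hk, smul_smul]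
    simp [MonoidAlgebra.single_mul_single]
  let e : τ.asModule ≃ₗ[MonoidAlgebra k G] N :=
    { τ.asModuleEquiv with
      map_smul' := fun r x => by
        change τ.asModuleEquiv (r • x) = r • τ.asModuleEquiv x
        induction r using MonoidAlgebra.induction_linear with
        | zero => simp
        | add a b ha hb => simp only [add_smul, map_add, ha, hb]
        | single g a =>
          rw [Representation.single_smul, hsingle]
          rfl }
  have h : τ.IsIrreducible :=
    (irreducible_iff_isSimpleModule_asModule τ).mpr (IsSimpleModule.congr e)
  obtain ⟨i, ⟨φ⟩⟩ := hρ.exists_equiv h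
  refine ⟨i, φ.toLinearEquiv.toAddEquiv, fun g a x => ?_⟩
  rw [hsingle]
  change φ (a • τ g x) = a • ρ i g (φ x)
  rw [map_smul]
  exact congrArg (a • ·) (φ.toIntertwiningMap.isIntertwining _ _ g x)

/-- Maschke's theorem: invertibility of the group order makes the group algebra semisimple. -/
theorem IsCompleteIrreducibles.exists_equiv_pi {k : Type u} [Field k]
    {G : Type v} [Group G] [Finite G] [NeZero (Nat.card G : k)] {ι : Type} {W : ι → Type w}
    [∀ i, AddCommGroup (W i)] [∀ i, Module k (W i)]
    {ρ : ∀ i, Representation k G (W i)} (hρ : IsCompleteIrreducibles ρ) {U : Type*}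
    [AddCommGroup U] [Module k U] [FiniteDimensional k U] (σ : Representation k G U) :
    ∃ (m : ℕ) (τ : Fin m → ι), Nonempty (σ.Equiv (pi fun j => ρ (τ j))) := by
  have hfin : Module.Finite (MonoidAlgebra k G) σ.asModule := by
    have : Module.Finite k σ.asModule := inferInstanceAs (Module.Finite k U)
    exact Module.Finite.of_restrictScalars_finite k _ _
  obtain ⟨m, S, e, hS⟩ := IsSemisimpleModule.exists_linearEquiv_fin_dfinsupp
    (MonoidAlgebra k G) σ.asModule
  have h1 := fun j => have := hS j; hρ.exists_addEquiv_of_isSimpleModule (S j)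
  choose τ φ hφ using h1
  let F : U ≃+ (∀ j, W (τ j)) := (e.toAddEquiv.trans
    (DFinsupp.linearEquivFunOnFintype (R := MonoidAlgebra k G)).toAddEquiv).trans
    (AddEquiv.piCongrRight φ)
  have hF : ∀ (g : G) (a : k) (x : U), F (a • σ g x) = a • pi (fun j => ρ (τ j)) g (F x) := by
    intro g a x
    funext j
    change φ j (e (a • σ g x) j) = a • ρ (τ j) g (φ j (e x j))
    rw [← hφ]
    congr 1
    have h2 : MonoidAlgebra.single g a • σ.asModuleEquiv.symm x =
        σ.asModuleEquiv.symm (a • σ g x) := by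
      rw [Representation.single_smul]; rfl
    have h3 := e.map_smul (MonoidAlgebra.single g a) (σ.asModuleEquiv.symm x)
    exact (congrArg (fun z => e z j) h2.symm).trans (congrArg (fun z => z j) h3)
  refine ⟨m, τ, ⟨.mk (F.toLinearEquiv fun a x => ?_) fun g => LinearMap.ext fun x => ?_⟩⟩
  · simpa using hF 1 a x
  · simpa using hF g 1 x


/-- Grouping the factors of a finite product by isomorphism type. -/
theorem LinearEquiv.exists_pi_fiber {R : Type*} [Ring R] {ι J : Type*} [Finite J]
    (M : ι → Type*) [∀ i, AddCommGroup (M i)] [∀ i, Module R (M i)] (τ : J → ι) :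
    ∃ c : ι → ℕ, Nonempty ((∀ j, M (τ j)) ≃ₗ[R] ∀ i, Fin (c i) → M i) := by
  let c : ι → ℕ := fun i => Nat.card {j // τ j = i}
  let e : (Σ i, Fin (c i)) ≃ J :=
    (Equiv.sigmaCongrRight fun i => (Finite.equivFin {j // τ j = i}).symm).trans
      (Equiv.sigmaFiberEquiv τ)
  have he : ∀ x, τ (e x) = x.1 := fun x =>
    ((Finite.equivFin {j // τ j = x.1}).symm x.2).2
  have hM : ∀ x, Nonempty (M (τ (e x)) ≃ₗ[R] M x.1) := fun x => by
    rw [he]; exact ⟨LinearEquiv.refl R _⟩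
  refine ⟨c, ⟨?_⟩⟩
  exact (LinearEquiv.piCongrLeft R (fun j => M (τ j)) e).symm.trans
    ((LinearEquiv.piCongrRight fun x => (hM x).some).trans
      (LinearEquiv.piCurry R fun i (_ : Fin (c i)) => M i))

/-! ### Functoriality and additivity of covariants -/

section Functor

variable {k : Type u} {V : Type v} [Field k] [AddCommGroup V] [Module k V]
  (G : Subgroup (LinearMap.GeneralLinearGroup k V))

attribute [local instance] covariantModule.addCommGroupShortcut covariantModule.moduleShortcut
  covariantModule.smulShortcut

/-- Functoriality of the module of covariants. -/
def covariantMap {W W' : Type*} [AddCommGroup W] [Module k W] [AddCommGroup W'] [Module k W']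
    {ρ : Representation k G W} {σ : Representation k G W'} (f : IntertwiningMap ρ σ) :
    covariantModule G ρ →ₗ[invariantRing G] covariantModule G σ :=
  ((f.toLinearMap.baseChange (SymmetricAlgebra k V)).restrictScalars (invariantRing G)).restrict
    fun x hx g => by
      have h1 := (f.lTensor (symRep G)).isIntertwining _ _ g x
      rw [(mem_covariantModule G).mp hx g] at h1
      exact h1.symm

theorem coe_covariantMap {W W' : Type*} [AddCommGroup W] [Module k W] [AddCommGroup W']
    [Module k W'] {ρ : Representation k G W} {σ : Representation k G W'}
    (f : IntertwiningMap ρ σ) (x : covariantModule G ρ) :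
    (covariantMap G f x : SymmetricAlgebra k V ⊗[k] W') =
      f.toLinearMap.lTensor (SymmetricAlgebra k V) x := rfl

/-- Equivalent representations have isomorphic modules of covariants. -/
def covariantEquiv {W W' : Type*} [AddCommGroup W] [Module k W] [AddCommGroup W'] [Module k W']
    {ρ : Representation k G W} {σ : Representation k G W'} (φ : ρ.Equiv σ) :
    covariantModule G ρ ≃ₗ[invariantRing G] covariantModule G σ :=
  LinearEquiv.ofLinearMap (covariantMap G φ.toIntertwiningMap)
    (covariantMap G φ.symm.toIntertwiningMap)
    (LinearMap.ext fun x => Subtype.ext (by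
      rw [LinearMap.comp_apply, coe_covariantMap, coe_covariantMap, ← LinearMap.comp_apply,
        ← LinearMap.lTensor_comp,
        show φ.toIntertwiningMap.toLinearMap ∘ₗ φ.symm.toIntertwiningMap.toLinearMap =
          LinearMap.id from LinearMap.ext φ.apply_symm_apply, LinearMap.lTensor_id]
      rfl))
    (LinearMap.ext fun x => Subtype.ext (by
      rw [LinearMap.comp_apply, coe_covariantMap, coe_covariantMap, ← LinearMap.comp_apply,
        ← LinearMap.lTensor_comp,
        show φ.symm.toIntertwiningMap.toLinearMap ∘ₗ φ.toIntertwiningMap.toLinearMap =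
          LinearMap.id from LinearMap.ext φ.symm_apply_apply, LinearMap.lTensor_id]
      rfl))

/-- The module of covariants of a finite product. -/
def covariantPiEquiv {J : Type*} [Fintype J] [DecidableEq J] {W : J → Type*}
    [∀ j, AddCommGroup (W j)] [∀ j, Module k (W j)] (ρ : ∀ j, Representation k G (W j)) :
    covariantModule G (Representation.pi ρ) ≃ₗ[invariantRing G] ∀ j, covariantModule G (ρ j) :=
  let proj (j : J) : IntertwiningMap (Representation.pi ρ) (ρ j) :=
    ⟨LinearMap.proj j, fun _ => rfl⟩
  let single (j : J) : IntertwiningMap (ρ j) (Representation.pi ρ) :=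
    ⟨LinearMap.single k W j, fun g => LinearMap.ext fun x => funext fun i => by
      rcases eq_or_ne i j with rfl | h
      · simp
      · simp [h]⟩
  LinearEquiv.ofLinearMap (LinearMap.pi fun j => covariantMap G (proj j))
    (∑ j, covariantMap G (single j) ∘ₗ LinearMap.proj j)
    (LinearMap.ext fun x => funext fun i => Subtype.ext (by
      simp only [LinearMap.comp_apply, LinearMap.pi_apply, LinearMap.sum_apply,
        LinearMap.proj_apply, LinearMap.id_apply, map_sum, AddSubmonoidClass.coe_finsetSum,
        coe_covariantMap]
      rw [Finset.sum_eq_single i]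
      · rw [← LinearMap.comp_apply, ← LinearMap.lTensor_comp, LinearMap.proj_comp_single_same,
          LinearMap.lTensor_id]
        rfl
      · intro j _ hj
        rw [← LinearMap.comp_apply, ← LinearMap.lTensor_comp,
          LinearMap.proj_comp_single_ne _ _ _ _ hj.symm, LinearMap.lTensor_zero]
        rfl
      · simp))
    (LinearMap.ext fun x => Subtype.ext (by
      have h1 : ∑ j, (single j).toLinearMap ∘ₗ (proj j).toLinearMap = LinearMap.id :=
        LinearMap.ext fun y => by
          simp only [LinearMap.sum_apply, LinearMap.comp_apply]
          exact Finset.univ_sum_single y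
      have h2 := congrArg (fun f => LinearMap.lTensorHom (R := k) (SymmetricAlgebra k V) f
        (x : SymmetricAlgebra k V ⊗[k] (∀ j, W j))) h1
      simp only [map_sum, LinearMap.sum_apply, LinearMap.coe_lTensorHom, LinearMap.lTensor_id,
        LinearMap.lTensor_comp, LinearMap.comp_apply] at h2
      simp only [LinearMap.comp_apply, LinearMap.pi_apply, LinearMap.sum_apply,
        LinearMap.proj_apply, LinearMap.id_apply, AddSubmonoidClass.coe_finsetSum,
        coe_covariantMap]
      exact h2))

end Functor

/-! ### Existence and uniqueness of the multiplicities -/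

section Decomposition

variable {k : Type u} {V : Type v} [Field k] [AddCommGroup V] [Module k V]
  {G : Subgroup (LinearMap.GeneralLinearGroup k V)}

/-- Schur's lemma over an algebraically closed field: only the copies of `ρ i` itself contribute,
one dimension each. -/
theorem IsCompleteIrreducibles.finrank_intertwiningMap_pi [IsAlgClosed k] [Finite G]
    {n : ℕ} {W : Fin (n + 1) → Type w} [∀ i, AddCommGroup (W i)] [∀ i, Module k (W i)]
    {ρ : ∀ i, Representation k G (W i)} (hρ : IsCompleteIrreducibles ρ) (c : Fin (n + 1) → ℕ)
    (i : Fin (n + 1)) :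
    Module.finrank k (IntertwiningMap (ρ i)
      (Representation.pi fun x : Σ i, Fin (c i) => ρ x.1)) = c i := by
  have hf : ∀ i, FiniteDimensional k (W i) := fun i => (hρ.irreducible i).finiteDimensional
  rw [(IntertwiningMap.piEquiv (ρ i) fun x : Σ i, Fin (c i) => ρ x.1).finrank_eq,
    Module.finrank_pi_fintype]
  simp only [hρ.finrank_intertwiningMap, Fintype.sum_sigma]
  rw [Finset.sum_eq_single i]
  · simp
  · intro b _ hb
    simp [hb.symm]
  · simp

/-- If `ᵉR` is the module of covariants of a representation `σ`, the multiplicities in the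
decomposition of `ᵉR` are those of the irreducible constituents of `σ`. -/
theorem isFrobeniusDecomposition_iff [IsAlgClosed k] [FiniteDimensional k V] [Finite G]
    (p : ℕ) [ExpChar k p] [NeZero (Nat.card G : k)] (hG : NoPseudoReflections G)
    {n : ℕ} {W : Fin (n + 1) → Type w} [∀ i, AddCommGroup (W i)] [∀ i, Module k (W i)]
    {ρ : ∀ i, Representation k G (W i)} (hρ : IsCompleteIrreducibles ρ) (e : ℕ)
    {T : Type*} [AddCommGroup T] [Module k T] [FiniteDimensional k T] (σ : Representation k G T)
    (Ψ : FrobeniusPushforward (invariantRing G) p e (invariantRing G) ≃ₗ[invariantRing G]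
      covariantModule G σ) (c : Fin (n + 1) → ℕ) :
    IsFrobeniusDecomposition G p ρ e c ↔
      c = fun i => Module.finrank k (IntertwiningMap (ρ i) σ) := by
  classical
  have hf : ∀ i, FiniteDimensional k (W i) := fun i => (hρ.irreducible i).finiteDimensional
  have key : ∀ c, IsFrobeniusDecomposition G p ρ e c →
      c = fun i => Module.finrank k (IntertwiningMap (ρ i) σ) := by
    rintro c ⟨Θ⟩
    -- A decomposition of ᵉR presents it as the covariants of ⊕ W_i^{c_i}, so this representation
    -- must be isomorphic to `σ`.
    let τ := Representation.pi fun x : Σ i, Fin (c i) => ρ x.1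
    have E : covariantModule G τ ≃ₗ[invariantRing G] ∀ i, Fin (c i) → covariantModule G (ρ i) :=
      (covariantPiEquiv G _).trans
        (LinearEquiv.piCurry _ fun i (_ : Fin (c i)) => covariantModule G (ρ i))
    obtain ⟨φ⟩ := hG.nonempty_equiv_of_covariantModule_equiv σ τ
      (Ψ.symm.trans (Θ.trans E.symm))
    funext i
    rw [← hρ.finrank_intertwiningMap_pi c i]
    refine (LinearEquiv.finrank_eq ?_).symm
    exact LinearEquiv.ofLinearMap (IntertwiningMap.llcomp _ _ _ φ.toIntertwiningMap)
      (IntertwiningMap.llcomp _ _ _ φ.symm.toIntertwiningMap)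
      (LinearMap.ext fun f => IntertwiningMap.ext (LinearMap.ext fun x => φ.apply_symm_apply _))
      (LinearMap.ext fun f => IntertwiningMap.ext (LinearMap.ext fun x => φ.symm_apply_apply _))
  refine ⟨key c, ?_⟩
  obtain ⟨m, τ, ⟨φ⟩⟩ := hρ.exists_equiv_pi σ
  obtain ⟨c', ⟨F⟩⟩ := LinearEquiv.exists_pi_fiber (R := invariantRing G)
    (fun i => covariantModule G (ρ i)) τ
  have h : IsFrobeniusDecomposition G p ρ e c' :=
    ⟨Ψ.trans ((covariantEquiv G φ).trans ((covariantPiEquiv G _).trans F))⟩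
  -- The decomposition just constructed obeys the formula by `key`, so its multiplicities are the
  -- prescribed ones.
  rintro hc
  rwa [hc, ← key c' h]

end Decomposition

/-! ### Polynomials modulo q-th powers of the variables -/

namespace MvPolynomial

variable {k : Type*} [Field k] {d : ℕ}

/-- The ideal generated by the `q`-th powers of the variables. -/
def powIdeal (k : Type*) [Field k] (d q : ℕ) : Ideal (MvPolynomial (Fin d) k) :=
  Ideal.span ((fun s => monomial s (1 : k)) '' Set.range fun i => Finsupp.single i q)

theorem mem_powIdeal {q : ℕ} {f : MvPolynomial (Fin d) k} :
    f ∈ powIdeal k d q ↔ ∀ m ∈ f.support, ∃ i, q ≤ m i := by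
  rw [powIdeal, mem_ideal_span_monomial_image]
  simp

theorem X_pow_mem_powIdeal (q : ℕ) (i : Fin d) : (X i : MvPolynomial (Fin d) k) ^ q ∈
    powIdeal k d q := by
  rw [X_pow_eq_monomial]
  exact Ideal.subset_span ⟨_, ⟨i, rfl⟩, rfl⟩

theorem powIdeal_le {q : ℕ} {I : Ideal (MvPolynomial (Fin d) k)} (h : ∀ i, X i ^ q ∈ I) :
    powIdeal k d q ≤ I := by
  rw [powIdeal, Ideal.span_le]
  rintro _ ⟨_, ⟨i, rfl⟩, rfl⟩
  simpa only [X_pow_eq_monomial, SetLike.mem_coe] using h i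

/-- The exponent vector of a tuple of bounded natural numbers. -/
def boundedExp {a : Fin d → ℕ} (b : ∀ i, Fin (a i)) : Fin d →₀ ℕ :=
  Finsupp.equivFunOnFinite.symm fun i => (b i : ℕ)

@[simp]
theorem boundedExp_apply {a : Fin d → ℕ} (b : ∀ i, Fin (a i)) (i : Fin d) :
    boundedExp b i = b i := rfl

theorem boundedExp_injective {a : Fin d → ℕ} :
    Function.Injective (boundedExp : (∀ i, Fin (a i)) → Fin d →₀ ℕ) := by
  intro b c h
  funext i
  exact Fin.ext (DFunLike.congr_fun h i)

/-- The polynomial with prescribed coefficients and exponents bounded by `a`. -/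
def boundedPoly (k : Type*) [Field k] (a : Fin d → ℕ) :
    ((∀ i, Fin (a i)) → k) →ₗ[k] MvPolynomial (Fin d) k :=
  ∑ b, monomial (boundedExp b) ∘ₗ LinearMap.proj b

theorem boundedPoly_apply (a : Fin d → ℕ) (c : (∀ i, Fin (a i)) → k) :
    boundedPoly k a c = ∑ b, monomial (boundedExp b) (c b) := by
  simp [boundedPoly]

/-- The coefficients at exponents bounded by `a`. -/
def boundedCoeff (k : Type*) [Field k] (a : Fin d → ℕ) :
    MvPolynomial (Fin d) k →ₗ[k] ((∀ i, Fin (a i)) → k) :=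
  LinearMap.pi fun b => lcoeff k (boundedExp b)

@[simp]
theorem boundedCoeff_apply (a : Fin d → ℕ) (f : MvPolynomial (Fin d) k) (b : ∀ i, Fin (a i)) :
    boundedCoeff k a f b = coeff (boundedExp b) f := rfl

theorem boundedCoeff_boundedPoly (a : Fin d → ℕ) (c : (∀ i, Fin (a i)) → k) :
    boundedCoeff k a (boundedPoly k a c) = c := by
  classical
  funext b
  rw [boundedCoeff_apply, boundedPoly_apply, coeff_sum]
  simp [coeff_monomial, boundedExp_injective.eq_iff]

theorem exists_of_mem_support_boundedPoly {a : Fin d → ℕ} {c : (∀ i, Fin (a i)) → k}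
    {m : Fin d →₀ ℕ} (h : m ∈ (boundedPoly k a c).support) : ∃ b, boundedExp b = m ∧ c b ≠ 0 := by
  classical
  rw [mem_support_iff, boundedPoly_apply, coeff_sum] at h
  obtain ⟨b, -, hb⟩ := Finset.exists_ne_zero_of_sum_ne_zero h
  rw [coeff_monomial] at hb
  split_ifs at hb with h1
  · exact ⟨b, h1, hb⟩
  · exact absurd rfl hb

/-- The ideal is monomial, and the monomials outside it are those with all exponents below `q`;
these form a basis of the quotient. -/
theorem boundedCoeff_eq_zero_iff {q : ℕ} {f : MvPolynomial (Fin d) k} :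
    boundedCoeff k (fun _ => q) f = 0 ↔ f ∈ powIdeal k d q := by
  rw [mem_powIdeal]
  constructor
  · intro h m hm
    by_contra! hlt
    have := congrFun h fun i => ⟨m i, hlt i⟩
    rw [boundedCoeff_apply, Pi.zero_apply] at this
    refine mem_support_iff.mp hm ?_
    rw [← this]
    congr 1
    ext i
    rfl
  · intro h
    funext b
    by_contra hne
    obtain ⟨i, hi⟩ := h _ (mem_support_iff.mpr hne)
    exact absurd (b i).2 (not_lt.mpr hi)

theorem totalDegree_boundedPoly_boundedCoeff_le (a : Fin d → ℕ) (f : MvPolynomial (Fin d) k) :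
    (boundedPoly k a (boundedCoeff k a f)).totalDegree ≤ f.totalDegree := by
  refine Finset.sup_mono fun m hm => ?_
  obtain ⟨b, rfl, hb⟩ := exists_of_mem_support_boundedPoly hm
  exact mem_support_iff.mpr hb

theorem totalDegree_algHom_le {ι κ : Type*} (φ : MvPolynomial ι k →ₐ[k] MvPolynomial κ k)
    (h : ∀ i, (φ (X i)).totalDegree ≤ 1) (f : MvPolynomial ι k) :
    (φ f).totalDegree ≤ f.totalDegree := by
  conv_lhs => rw [f.as_sum, map_sum]
  refine (totalDegree_finsetSum _ _).trans (Finset.sup_le fun m hm => ?_)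
  rw [monomial_eq, map_mul, Finsupp.prod, map_prod, ← algebraMap_eq, AlgHom.commutes]
  refine (totalDegree_mul _ _).trans ?_
  rw [algebraMap_eq, totalDegree_C, zero_add]
  refine (totalDegree_finsetProd _ _).trans ((Finset.sum_le_sum fun i _ => ?_).trans
    (le_totalDegree hm))
  rw [map_pow]
  exact (totalDegree_pow _ _).trans (by nlinarith [h i])

/-- A set of polynomials that is stable under multiplication by `q`-th powers of variables and
meets every class modulo these powers in low degree is everything. -/
theorem eq_top_of_powIdeal {q : ℕ} (hq : 0 < q) (N : AddSubgroup (MvPolynomial (Fin d) k))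
    (hX : ∀ i, ∀ f ∈ N, X i ^ q * f ∈ N)
    (h : ∀ f, ∃ c ∈ N, c.totalDegree ≤ f.totalDegree ∧ f - c ∈ powIdeal k d q) : N = ⊤ := by
  have key : ∀ n : ℕ, ∀ f : MvPolynomial (Fin d) k, f.totalDegree ≤ n → f ∈ N := by
    intro n
    induction n using Nat.strong_induction_on with
    | h n ih =>
    intro f hf
    obtain ⟨c, hcN, hc, hfc⟩ := h f
    rw [← sub_add_cancel f c]
    refine N.add_mem ?_ hcN
    have hdeg : (f - c).totalDegree ≤ n :=
      (totalDegree_sub _ _).trans (max_le hf (hc.trans hf))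
    rw [(f - c).as_sum]
    refine N.sum_mem fun m hm => ?_
    -- Each monomial of `f - c` is `X i ^ q` times a monomial of degree smaller by `q > 0`, which
    -- lies in `N` by induction. This is why `c` may not have larger degree than `f`.
    obtain ⟨i, hi⟩ := mem_powIdeal.mp hfc m hm
    have hmi : m = Finsupp.single i q + (m - Finsupp.single i q) := by
      rw [add_tsub_cancel_of_le (Finsupp.single_le_iff.mpr hi)]
    have h1 : monomial m (coeff m (f - c)) =
        X i ^ q * monomial (m - Finsupp.single i q) (coeff m (f - c)) := by
      rw [X_pow_eq_monomial, monomial_mul, one_mul, ← hmi]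
    rw [h1]
    have h2 : m.sum (fun _ e => e) = q + (m - Finsupp.single i q).sum fun _ e => e := by
      conv_lhs => rw [hmi]
      rw [Finsupp.sum_add_index' (by simp) (by simp), Finsupp.sum_single_index rfl]
    have h3 := (le_totalDegree hm).trans hdeg
    refine hX i _ (ih _ ?_ _ (totalDegree_monomial_le _ _))
    change (m - Finsupp.single i q).sum (fun _ e => e) < n
    omega
  exact eq_top_iff.mpr fun f _ => key _ f le_rfl

open MonomialOrder in
/-- The polynomial ring is free over its subring of `q`-th powers on monomials. -/
theorem sum_pow_mul_monomial_injective {q : ℕ} (c : (Fin d → Fin q) → MvPolynomial (Fin d) k)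
    (h : ∑ b, c b ^ q * monomial (boundedExp b) 1 = 0) : c = 0 := by
  classical
  by_contra hne
  let F : Finset (Fin d → Fin q) := {b | c b ≠ 0}
  have hF : F.Nonempty := by
    obtain ⟨b, hb⟩ := Function.ne_iff.mp hne
    exact ⟨b, by simpa [F] using hb⟩
  -- The lex-leading exponent of the `b`-th summand. Residues modulo `q` recover `b`, so distinct
  -- summands have distinct leading exponents and the largest cannot cancel.
  let D : (Fin d → Fin q) → Fin d →₀ ℕ := fun b => q • lex.degree (c b) + boundedExp b
  have hD : Function.Injective D := by
    intro b b' hbb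
    funext i
    have := DFunLike.congr_fun hbb i
    simp only [D, Finsupp.add_apply, Finsupp.smul_apply, smul_eq_mul, boundedExp_apply] at this
    have := congrArg (· % q) this
    simp only [Nat.mul_add_mod] at this
    rw [Nat.mod_eq_of_lt (b i).2, Nat.mod_eq_of_lt (b' i).2] at this
    exact Fin.ext this
  have hdeg : ∀ b, c b ≠ 0 → lex.degree (c b ^ q * monomial (boundedExp b) 1) = D b := by
    intro b hb
    rw [degree_mul (pow_ne_zero _ hb) (by simp), degree_pow, degree_monomial]
    simp [D]
  obtain ⟨b0, hb0, hmax⟩ := F.exists_max_image (fun b => lex.toSyn (D b)) hF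
  have hc0 : c b0 ≠ 0 := by simpa [F] using hb0
  have h1 := congrArg (coeff (D b0)) h
  rw [coeff_sum, Finset.sum_eq_single b0, coeff_zero] at h1
  · rw [← hdeg b0 hc0] at h1
    exact (coeff_degree_ne_zero_iff (m := lex)).mpr (mul_ne_zero (pow_ne_zero _ hc0) (by simp)) h1
  · intro b _ hb
    by_cases hcb : c b = 0
    -- Needed for `0 ^ q = 0`. If `q = 0`, the index type is empty or, when there are no variables,
    -- a single point, contradicting `b ≠ b0`.
    · have : q ≠ 0 := by
        rintro rfl
        by_cases hd : IsEmpty (Fin d)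
        · exact hb (Subsingleton.elim _ _)
        · rw [not_isEmpty_iff] at hd
          exact (b hd.some).elim0
      simp [hcb, this]
    · refine coeff_eq_zero_of_lt (m := lex) ?_
      rw [hdeg b hcb]
      exact lt_of_le_of_ne (hmax b (by simpa [F] using hcb))
        fun h => hb (hD (lex.toSyn.injective h))
  · simp

open MonomialOrder in
/-- Multiplication by a nonzero polynomial is injective on monomials of small degree modulo
`q`-th powers. -/
theorem mul_boundedPoly_notMem_powIdeal {q : ℕ} {f : MvPolynomial (Fin d) k} (hf : f ≠ 0)
    {c : (∀ i, Fin (q - lex.degree f i)) → k} (hc : c ≠ 0) :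
    f * boundedPoly k _ c ∉ powIdeal k d q := by
  have hu : boundedPoly k _ c ≠ 0 := by
    intro h
    apply hc
    rw [← boundedCoeff_boundedPoly _ c, h, map_zero]
  intro hmem
  obtain ⟨i, hi⟩ := mem_powIdeal.mp hmem (lex.degree (f * boundedPoly k _ c))
    (mem_support_iff.mpr ((coeff_degree_ne_zero_iff (m := lex)).mpr (mul_ne_zero hf hu)))
  obtain ⟨b, hb, -⟩ := exists_of_mem_support_boundedPoly
    (mem_support_iff.mpr ((coeff_degree_ne_zero_iff (m := lex)).mpr hu))
  -- The leading exponent of the product is that of `f` plus a bounded one, hence below `q` in every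
  -- coordinate.
  rw [degree_mul hf hu, Finsupp.add_apply, ← hb, boundedExp_apply] at hi
  have := (b i).2
  omega

end MvPolynomial

/-! ### The symmetric algebra modulo q-th powers -/

section FrobeniusPower

variable (k : Type u) (V : Type v) [Field k] [AddCommGroup V] [Module k V]

/-- The ideal of `Sym V` generated by the `q`-th powers of vectors. -/
def symPowIdeal (q : ℕ) : Ideal (SymmetricAlgebra k V) :=
  Ideal.span (Set.range fun x : V => SymmetricAlgebra.ι k V x ^ q)

variable {k V}

theorem symPowIdeal_le_comap (q : ℕ) (f : V →ₗ[k] V) :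
    symPowIdeal k V q ≤ (symPowIdeal k V q).comap (symMap f) := by
  refine Ideal.span_le.mpr ?_
  rintro _ ⟨x, rfl⟩
  simp only [SetLike.mem_coe, Ideal.mem_comap, map_pow, symMap_ι]
  exact Ideal.subset_span ⟨f x, rfl⟩

variable [FiniteDimensional k V]

/-- Coordinates on the symmetric algebra. -/
def symCoord (k : Type u) (V : Type v) [Field k] [AddCommGroup V] [Module k V]
    [FiniteDimensional k V] :
    SymmetricAlgebra k V ≃ₐ[k] MvPolynomial (Fin (Module.finrank k V)) k :=
  SymmetricAlgebra.equivMvPolynomial (Module.finBasis k V)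

theorem symCoord_symm_X (i : Fin (Module.finrank k V)) : (symCoord k V).symm (MvPolynomial.X i) =
    SymmetricAlgebra.ι k V (Module.finBasis k V i) :=
  SymmetricAlgebra.equivMvPolynomial_symm_X _ i

/-- The ideal is defined by all vectors so that its `G`-stability is visible. Because q is a power
of p, q-th powers are additive, and those of the basis vectors already generate it. -/
theorem mem_symPowIdeal_iff (p : ℕ) [ExpChar k p] (e : ℕ) {s : SymmetricAlgebra k V} :
    s ∈ symPowIdeal k V (p ^ e) ↔
      symCoord k V s ∈ MvPolynomial.powIdeal k (Module.finrank k V) (p ^ e) := by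
  constructor
  · revert s
    change symPowIdeal k V (p ^ e) ≤ (MvPolynomial.powIdeal k _ (p ^ e)).comap (symCoord k V)
    refine Ideal.span_le.mpr ?_
    rintro _ ⟨x, rfl⟩
    have := expChar_of_injective_algebraMap
      (algebraMap k (MvPolynomial (Fin (Module.finrank k V)) k)).injective p
    rw [SetLike.mem_coe, Ideal.mem_comap, map_pow, ← (Module.finBasis k V).sum_repr x,
      map_sum, map_sum, sum_pow_char_pow]
    refine Ideal.sum_mem _ fun i _ => ?_
    rw [map_smul, map_smul, ← symCoord_symm_X, AlgEquiv.apply_symm_apply, smul_pow]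
    exact Submodule.smul_of_tower_mem _ _ (MvPolynomial.X_pow_mem_powIdeal _ i)
  · intro h
    have h1 : MvPolynomial.powIdeal k _ (p ^ e) ≤
        (symPowIdeal k V (p ^ e)).comap (symCoord k V).symm := by
      refine MvPolynomial.powIdeal_le fun i => ?_
      rw [Ideal.mem_comap, map_pow, symCoord_symm_X]
      exact Ideal.subset_span ⟨_, rfl⟩
    have := h1 h
    rwa [Ideal.mem_comap, AlgEquiv.symm_apply_apply] at this

/-- The quotient of `Sym V` by `q`-th powers in coordinates. -/
def symPowQuotientEquiv (k : Type u) (V : Type v) [Field k] [AddCommGroup V] [Module k V]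
    [FiniteDimensional k V] (p : ℕ) [ExpChar k p] (e : ℕ) :
    (SymmetricAlgebra k V ⧸ symPowIdeal k V (p ^ e)) ≃ₗ[k]
      ((Fin (Module.finrank k V) → Fin (p ^ e)) → k) :=
  LinearEquiv.ofLinearMap
    (((symPowIdeal k V (p ^ e)).restrictScalars k).liftQ
      (MvPolynomial.boundedCoeff k (fun _ => p ^ e) ∘ₗ (symCoord k V).toLinearMap) (fun s hs => by
        rw [LinearMap.mem_ker]
        exact MvPolynomial.boundedCoeff_eq_zero_iff.mpr ((mem_symPowIdeal_iff p e).mp hs)) ∘ₗ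
      (Submodule.Quotient.restrictScalarsEquiv k (symPowIdeal k V (p ^ e))).symm.toLinearMap)
    ((Ideal.Quotient.mkₐ k (symPowIdeal k V (p ^ e))).toLinearMap ∘ₗ
      (symCoord k V).symm.toLinearMap ∘ₗ MvPolynomial.boundedPoly k (fun _ => p ^ e))
    (by
      refine LinearMap.ext fun c => ?_
      change MvPolynomial.boundedCoeff k _ (symCoord k V ((symCoord k V).symm _)) = c
      rw [AlgEquiv.apply_symm_apply, MvPolynomial.boundedCoeff_boundedPoly])
    (by
      refine LinearMap.ext fun t => ?_
      obtain ⟨s, rfl⟩ := Ideal.Quotient.mk_surjective t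
      change Ideal.Quotient.mk _ ((symCoord k V).symm (MvPolynomial.boundedPoly k _
        (MvPolynomial.boundedCoeff k (fun _ => p ^ e) (symCoord k V s)))) = Ideal.Quotient.mk _ s
      rw [Ideal.Quotient.mk_eq_mk_iff_sub_mem, mem_symPowIdeal_iff, map_sub,
        AlgEquiv.apply_symm_apply, ← MvPolynomial.boundedCoeff_eq_zero_iff, map_sub,
        MvPolynomial.boundedCoeff_boundedPoly, sub_self])

instance (p : ℕ) [ExpChar k p] (e : ℕ) :
    FiniteDimensional k (SymmetricAlgebra k V ⧸ symPowIdeal k V (p ^ e)) :=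
  (symPowQuotientEquiv k V p e).symm.finiteDimensional

theorem finrank_symPowQuotient (p : ℕ) [ExpChar k p] (e : ℕ) :
    Module.finrank k (SymmetricAlgebra k V ⧸ symPowIdeal k V (p ^ e)) =
      p ^ (Module.finrank k V * e) := by
  rw [(symPowQuotientEquiv k V p e).finrank_eq, Module.finrank_fintype_fun_eq_card,
    Fintype.card_fun, Fintype.card_fin, Fintype.card_fin, ← pow_mul, mul_comm]

/-- The kernel of multiplication by a fixed nonzero element modulo `q`-th powers is small. -/
theorem exists_finrank_ker_symPowQuotient_le (p : ℕ) [ExpChar k p] {f : SymmetricAlgebra k V}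
    (hf : f ≠ 0) : ∃ a : Fin (Module.finrank k V) → ℕ, ∀ e : ℕ,
      Module.finrank k (LinearMap.ker (Algebra.lsmul k k
        (SymmetricAlgebra k V ⧸ symPowIdeal k V (p ^ e)) f)) + ∏ i, (p ^ e - a i) ≤
        p ^ (Module.finrank k V * e) := by
  have hf' : symCoord k V f ≠ 0 := by simpa using hf
  refine ⟨fun i => MonomialOrder.lex.degree (symCoord k V f) i, fun e => ?_⟩
  let μ := Algebra.lsmul k k (SymmetricAlgebra k V ⧸ symPowIdeal k V (p ^ e)) f
  let u := (Ideal.Quotient.mkₐ k (symPowIdeal k V (p ^ e))).toLinearMap ∘ₗ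
    (symCoord k V).symm.toLinearMap ∘ₗ MvPolynomial.boundedPoly k
      (fun i => p ^ e - MonomialOrder.lex.degree (symCoord k V f) i)
  -- Multiplication by `f` is injective on polynomials with exponents below `q - a i`, where `a` is
  -- the lex-leading exponent of `f`, so its rank is at least their number ∏ (q − a_i).
  have hinj : Function.Injective (μ ∘ₗ u) := by
    rw [injective_iff_map_eq_zero]
    intro c hc
    by_contra hne
    have hc' : Ideal.Quotient.mk (symPowIdeal k V (p ^ e))
        (f * (symCoord k V).symm (MvPolynomial.boundedPoly k _ c)) = 0 := hc
    rw [Ideal.Quotient.eq_zero_iff_mem, mem_symPowIdeal_iff, map_mul,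
      AlgEquiv.apply_symm_apply] at hc'
    exact MvPolynomial.mul_boundedPoly_notMem_powIdeal hf' hne hc'
  have h1 : ∏ i, (p ^ e - MonomialOrder.lex.degree (symCoord k V f) i) ≤
      Module.finrank k (LinearMap.range μ) := by
    have h2 := LinearMap.finrank_range_of_inj hinj
    rw [Module.finrank_fintype_fun_eq_card, Fintype.card_pi] at h2
    simp only [Fintype.card_fin] at h2
    rw [← h2]
    exact Submodule.finrank_mono (LinearMap.range_comp_le_range _ _)
  have h3 := μ.finrank_range_add_finrank_ker
  rw [finrank_symPowQuotient] at h3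
  change Module.finrank k (LinearMap.ker μ) +
    ∏ i, (p ^ e - MonomialOrder.lex.degree (symCoord k V f) i) ≤ _
  omega

end FrobeniusPower

/-! ### Frobenius twists and the equivariant section -/

/-- The identity map from a Frobenius pushforward. -/
def FrobeniusPushforward.addEquiv (A : Type u) (p e : ℕ) (M : Type v) [CommRing A] [AddCommGroup M]
    [Module A M] : FrobeniusPushforward A p e M ≃+ M :=
  AddEquiv.refl M

theorem FrobeniusPushforward.addEquiv_smul (A : Type u) (p e : ℕ) (M : Type v) [CommRing A]
    [ExpChar A p] [AddCommGroup M] [Module A M] (a : A) (x : FrobeniusPushforward A p e M) :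
    addEquiv A p e M (a • x) = a ^ p ^ e • addEquiv A p e M x := rfl

/-- The Frobenius twist of a representation. -/
def Representation.frobeniusTwist {k : Type u} [Field k] (p e : ℕ) [ExpChar k p] {G : Type*}
    [Group G] {M : Type*} [AddCommGroup M] [Module k M] (ρ : Representation k G M) :
    Representation k G (FrobeniusPushforward k p e M) where
  toFun g :=
    { toFun := fun x => ρ g x
      map_add' := fun x y => (ρ g).map_add x y
      map_smul' := fun a x => (ρ g).map_smul (a ^ p ^ e) x }
  map_one' := LinearMap.ext fun x => LinearMap.congr_fun (map_one ρ) x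
  map_mul' g h := LinearMap.ext fun x => LinearMap.congr_fun (map_mul ρ g h) x

section Twist

variable (k : Type u) {V : Type v} [Field k] [AddCommGroup V] [Module k V]

/-- Frobenius pushforward over a perfect field preserves dimensions. -/
theorem FrobeniusPushforward.finrank_eq [PerfectField k] (p e : ℕ) [ExpChar k p] {M N : Type*}
    [AddCommGroup M] [Module k M] [AddCommGroup N] [Module k N]
    (j : N ≃+ M) (hj : ∀ (a : k) (x : N), j (a • x) = a ^ p ^ e • j x) :
    Module.finrank k N = Module.finrank k M := by
  have : PerfectRing k p := PerfectField.toPerfectRing p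
  have h := lift_rank_eq_of_equiv_equiv (iterateFrobenius k p e) j
    (bijective_iterateFrobenius k p e) hj
  simpa [Module.finrank] using congrArg Cardinal.toNat h

theorem FrobeniusPushforward.finiteDimensional [PerfectField k] (p e : ℕ) [ExpChar k p]
    (M : Type*) [AddCommGroup M] [Module k M] [FiniteDimensional k M] :
    FiniteDimensional k (FrobeniusPushforward k p e M) := by
  have : PerfectRing k p := PerfectField.toPerfectRing p
  have h := rank_eq_of_equiv_equiv (iterateFrobenius k p e)
    (FrobeniusPushforward.addEquiv k p e M)
    (bijective_iterateFrobenius k p e) (FrobeniusPushforward.addEquiv_smul k p e M)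
  refine Module.rank_lt_aleph0_iff.mp ?_
  rw [h]
  exact Module.rank_lt_aleph0 k M

end Twist

section Pushforward

variable {k : Type u} {V : Type v} [Field k] [AddCommGroup V] [Module k V]
  (G : Subgroup (LinearMap.GeneralLinearGroup k V))

/-- The action of `G` on `Sym V` modulo `q`-th powers. -/
def symPowRep (q : ℕ) : Representation k G (SymmetricAlgebra k V ⧸ symPowIdeal k V q) where
  toFun g := (Ideal.quotientMapₐ (symPowIdeal k V q)
    (symMap ((g : LinearMap.GeneralLinearGroup k V) : V →ₗ[k] V))
    (symPowIdeal_le_comap q _)).toLinearMap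
  map_one' := LinearMap.ext fun t => by
    obtain ⟨s, rfl⟩ := Ideal.Quotient.mk_surjective t
    exact congrArg (Ideal.Quotient.mk _) (one_smul G s)
  map_mul' g h := LinearMap.ext fun t => by
    obtain ⟨s, rfl⟩ := Ideal.Quotient.mk_surjective t
    exact congrArg (Ideal.Quotient.mk _) (mul_smul g h s)

theorem symPowRep_mk (q : ℕ) (g : G) (s : SymmetricAlgebra k V) :
    symPowRep G q g (Ideal.Quotient.mk _ s) = Ideal.Quotient.mk _ (g • s) := rfl

theorem symPowRep_smul (q : ℕ) (g : G) (s : SymmetricAlgebra k V)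
    (t : SymmetricAlgebra k V ⧸ symPowIdeal k V q) :
    symPowRep G q g (s • t) = (g • s) • symPowRep G q g t := by
  obtain ⟨x, rfl⟩ := Ideal.Quotient.mk_surjective t
  exact congrArg (Ideal.Quotient.mk _) (smul_mul' g s x)

variable [FiniteDimensional k V]

theorem totalDegree_symCoord_smul_le (g : G) (s : SymmetricAlgebra k V) :
    (symCoord k V (g • s)).totalDegree ≤ (symCoord k V s).totalDegree := by
  let φ := ((symCoord k V).toAlgHom.comp
    (symMap ((g : LinearMap.GeneralLinearGroup k V) : V →ₗ[k] V))).comp (symCoord k V).symm.toAlgHom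
  have h1 : symCoord k V (g • s) = φ (symCoord k V s) := by
    change _ = symCoord k V (g • (symCoord k V).symm (symCoord k V s))
    rw [AlgEquiv.symm_apply_apply]
  rw [h1]
  refine MvPolynomial.totalDegree_algHom_le φ (fun i => ?_) _
  change (symCoord k V (g • (symCoord k V).symm (MvPolynomial.X i))).totalDegree ≤ 1
  rw [symCoord_symm_X, symAction_smul_ι]
  exact (SymmetricAlgebra.isHomogeneous_equivMvPolynomial_ι _ _).totalDegree_le

/-- There is an equivariant section of the reduction modulo `q`-th powers that does not raise
degrees. -/
theorem exists_equivariant_section (p : ℕ) [ExpChar k p] [Finite G] [NeZero (Nat.card G : k)]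
    (e : ℕ) : ∃ σ : (SymmetricAlgebra k V ⧸ symPowIdeal k V (p ^ e)) →ₗ[k] SymmetricAlgebra k V,
      (∀ t, Ideal.Quotient.mk _ (σ t) = t) ∧
      (∀ g t, σ (symPowRep G _ g t) = g • σ t) ∧
      ∀ s, (symCoord k V (σ (Ideal.Quotient.mk _ s))).totalDegree ≤
        (symCoord k V s).totalDegree := by
  have := Fintype.ofFinite G
  have hcard : (Fintype.card G : k) ≠ 0 := by
    rw [← Nat.card_eq_fintype_card]; exact NeZero.ne _
  let σ₀ : (SymmetricAlgebra k V ⧸ symPowIdeal k V (p ^ e)) →ₗ[k] SymmetricAlgebra k V :=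
    (symCoord k V).symm.toLinearMap ∘ₗ MvPolynomial.boundedPoly k (fun _ => p ^ e) ∘ₗ
      (symPowQuotientEquiv k V p e).toLinearMap
  have h₀ : ∀ t, Ideal.Quotient.mk _ (σ₀ t) = t := fun t =>
    (symPowQuotientEquiv k V p e).symm_apply_apply t
  have hd₀ : ∀ s, (symCoord k V (σ₀ (Ideal.Quotient.mk _ s))).totalDegree ≤
      (symCoord k V s).totalDegree := by
    intro s
    have : symCoord k V (σ₀ (Ideal.Quotient.mk _ s)) = MvPolynomial.boundedPoly k _
        (MvPolynomial.boundedCoeff k (fun _ => p ^ e) (symCoord k V s)) :=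
      AlgEquiv.apply_symm_apply _ _
    rw [this]
    exact MvPolynomial.totalDegree_boundedPoly_boundedCoeff_le _ _
  -- The average of the conjugates of the monomial section. The group acts by linear substitutions,
  -- so averaging preserves the degree bound.
  let σ : (SymmetricAlgebra k V ⧸ symPowIdeal k V (p ^ e)) →ₗ[k] SymmetricAlgebra k V :=
    (Fintype.card G : k)⁻¹ • ∑ g : G, symRep G g ∘ₗ σ₀ ∘ₗ symPowRep G (p ^ e) g⁻¹
  have hσ : ∀ t, σ t = (Fintype.card G : k)⁻¹ • ∑ g : G, g • σ₀ (symPowRep G (p ^ e) g⁻¹ t) :=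
    fun t => by simp [σ, symAction_smul_def]
  refine ⟨σ, fun t => ?_, fun g t => ?_, fun s => ?_⟩
  · have h1 : ∀ g : G, Ideal.Quotient.mk (symPowIdeal k V (p ^ e))
        (g • σ₀ (symPowRep G (p ^ e) g⁻¹ t)) = t := by
      intro g
      rw [← symPowRep_mk, h₀, ← Module.End.mul_apply, ← map_mul, mul_inv_cancel, map_one,
        Module.End.one_apply]
    have h2 : ∀ (a : k) (s : SymmetricAlgebra k V),
      Ideal.Quotient.mk (symPowIdeal k V (p ^ e)) (a • s) = a • Ideal.Quotient.mk _ s :=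
        fun _ _ => rfl
    rw [hσ, h2, map_sum, Finset.sum_congr rfl fun g _ => h1 g, Finset.sum_const,
      Finset.card_univ, ← Nat.cast_smul_eq_nsmul k, inv_smul_smul₀ hcard]
  · rw [hσ, hσ, smul_comm, Finset.smul_sum (r := g)]
    congr 1
    symm
    refine Fintype.sum_equiv (Equiv.mulLeft g) _ _ fun l => ?_
    rw [Equiv.coe_mulLeft, mul_inv_rev, map_mul, Module.End.mul_apply, smul_smul,
      ← Module.End.mul_apply (symPowRep G (p ^ e) g⁻¹), ← map_mul, inv_mul_cancel, map_one,
      Module.End.one_apply]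
  · rw [hσ, map_smul (symCoord k V), map_sum]
    refine (MvPolynomial.totalDegree_smul_le _ _).trans
      ((MvPolynomial.totalDegree_finsetSum _ _).trans (Finset.sup_le fun g _ => ?_))
    rw [symPowRep_mk]
    exact (totalDegree_symCoord_smul_le G g _).trans
      ((hd₀ _).trans (totalDegree_symCoord_smul_le G g⁻¹ s))

end Pushforward

/-! ### The pushforward of the invariant ring as covariants -/

section FrobeniusStructure

attribute [local instance] covariantModule.addCommGroupShortcut covariantModule.moduleShortcut
  covariantModule.smulShortcut

variable {k : Type u} {V : Type v} [Field k] [AddCommGroup V] [Module k V]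

theorem symPow_add (p : ℕ) [ExpChar k p] (e : ℕ) (a b : SymmetricAlgebra k V) :
    (a + b) ^ p ^ e = a ^ p ^ e + b ^ p ^ e := by
  have := expChar_of_injective_algebraMap (algebraMap k (SymmetricAlgebra k V)).injective p
  exact map_add (iterateFrobenius (SymmetricAlgebra k V) p e) a b

/-- The map `S ⊗ ᵉT → ᵉS`, `s ⊗ t ↦ s^q σ(t)`. -/
def frobeniusTensorMap (p : ℕ) [ExpChar k p] (e : ℕ) {T : Type*} [AddCommGroup T] [Module k T]
    (σ : T →ₗ[k] SymmetricAlgebra k V) :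
    SymmetricAlgebra k V ⊗[k] FrobeniusPushforward k p e T →+ SymmetricAlgebra k V :=
  TensorProduct.liftAddHom
    { toFun := fun s =>
        (AddMonoidHom.mulLeft (s ^ p ^ e)).comp
          (σ.toAddMonoidHom.comp (FrobeniusPushforward.addEquiv k p e T).toAddMonoidHom)
      map_zero' := by
        ext t
        simp [(expChar_pos k p).ne']
      map_add' := fun a b => by
        ext t
        simp [symPow_add, add_mul] }
    -- Balancedness is the reason for twisting `T`: a scalar `r` leaves `s ^ q` as `r ^ q`, which is
    -- how it acts on the twist.
    (fun r s t => by
      change (r • s) ^ p ^ e * σ (FrobeniusPushforward.addEquiv k p e T t) =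
        s ^ p ^ e * σ (FrobeniusPushforward.addEquiv k p e T (r • t))
      rw [FrobeniusPushforward.addEquiv_smul, map_smul, smul_pow, smul_mul_assoc, mul_smul_comm])

theorem frobeniusTensorMap_tmul (p : ℕ) [ExpChar k p] (e : ℕ) {T : Type*} [AddCommGroup T]
    [Module k T] (σ : T →ₗ[k] SymmetricAlgebra k V) (s : SymmetricAlgebra k V)
    (t : FrobeniusPushforward k p e T) :
    frobeniusTensorMap p e σ (s ⊗ₜ t) =
      s ^ p ^ e * σ (FrobeniusPushforward.addEquiv k p e T t) := rfl

theorem frobeniusTensorMap_smul (p : ℕ) [ExpChar k p] (e : ℕ) {T : Type*} [AddCommGroup T]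
    [Module k T] (σ : T →ₗ[k] SymmetricAlgebra k V) (s : SymmetricAlgebra k V)
    (y : SymmetricAlgebra k V ⊗[k] FrobeniusPushforward k p e T) :
    frobeniusTensorMap p e σ (s • y) = s ^ p ^ e * frobeniusTensorMap p e σ y := by
  induction y using TensorProduct.induction_on with
  | zero => simp
  | tmul a t =>
    rw [TensorProduct.smul_tmul', frobeniusTensorMap_tmul, frobeniusTensorMap_tmul, smul_eq_mul,
      mul_pow, mul_assoc]
  | add a b ha hb => rw [smul_add, map_add, map_add, ha, hb, mul_add]

theorem frobeniusTensorMap_tprod (G : Subgroup (LinearMap.GeneralLinearGroup k V)) (p : ℕ)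
    [ExpChar k p] (e : ℕ) {T : Type*} [AddCommGroup T]
    [Module k T] (ρ : Representation k G T) (σ : T →ₗ[k] SymmetricAlgebra k V)
    (hσ : ∀ g t, σ (ρ g t) = g • σ t) (g : G)
    (y : SymmetricAlgebra k V ⊗[k] FrobeniusPushforward k p e T) :
    frobeniusTensorMap p e σ ((symRep G).tprod (ρ.frobeniusTwist p e) g y) =
      g • frobeniusTensorMap p e σ y := by
  induction y using TensorProduct.induction_on with
  | zero => simp
  | tmul a t =>
    rw [Representation.tprod_apply, TensorProduct.map_tmul, frobeniusTensorMap_tmul,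
      frobeniusTensorMap_tmul, ← symAction_smul_def, smul_mul', smul_pow', ← hσ]
    rfl
  | add a b ha hb => rw [map_add, map_add, map_add, smul_add, ha, hb]

variable [FiniteDimensional k V]

theorem addSubgroup_eq_top_of_symPowIdeal (p : ℕ) [ExpChar k p] (e : ℕ)
    (N : AddSubgroup (SymmetricAlgebra k V)) (hN : ∀ s, ∀ y ∈ N, s ^ p ^ e * y ∈ N)
    (h : ∀ s, ∃ c ∈ N, (symCoord k V c).totalDegree ≤ (symCoord k V s).totalDegree ∧
      Ideal.Quotient.mk (symPowIdeal k V (p ^ e)) c = Ideal.Quotient.mk _ s) : N = ⊤ := by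
  let ε : SymmetricAlgebra k V ≃+ MvPolynomial (Fin (Module.finrank k V)) k :=
    (symCoord k V).toRingEquiv.toAddEquiv
  have h1 : N.map ε.toAddMonoidHom = ⊤ := by
    refine MvPolynomial.eq_top_of_powIdeal (q := p ^ e) (pow_pos (expChar_pos k p) e) _ ?_ ?_
    · rintro i _ ⟨y, hy, rfl⟩
      refine ⟨(symCoord k V).symm (MvPolynomial.X i) ^ p ^ e * y, hN _ _ hy, ?_⟩
      change symCoord k V _ = _
      rw [map_mul, map_pow, AlgEquiv.apply_symm_apply]
      rfl
    · intro f
      obtain ⟨c, hc, hd, hm⟩ := h ((symCoord k V).symm f)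
      rw [AlgEquiv.apply_symm_apply] at hd
      refine ⟨symCoord k V c, ⟨c, hc, rfl⟩, hd, ?_⟩
      rw [eq_comm, Ideal.Quotient.mk_eq_mk_iff_sub_mem, mem_symPowIdeal_iff, map_sub,
        AlgEquiv.apply_symm_apply] at hm
      exact hm
  rw [eq_top_iff]
  intro s _
  obtain ⟨y, hy, hys⟩ : ε s ∈ N.map ε.toAddMonoidHom := h1 ▸ AddSubgroup.mem_top _
  rwa [← ε.injective hys]

/-- The range is stable under multiplication by q-th powers and contains the values of `σ`, which
represent every class without raising degree, so induction on degree applies. -/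
theorem frobeniusTensorMap_surjective (p : ℕ) [ExpChar k p] (e : ℕ)
    (σ : (SymmetricAlgebra k V ⧸ symPowIdeal k V (p ^ e)) →ₗ[k] SymmetricAlgebra k V)
    (hσ : ∀ t, Ideal.Quotient.mk _ (σ t) = t)
    (hd : ∀ s, (symCoord k V (σ (Ideal.Quotient.mk _ s))).totalDegree ≤
      (symCoord k V s).totalDegree) : Function.Surjective (frobeniusTensorMap p e σ) := by
  rw [← AddMonoidHom.range_eq_top]
  refine addSubgroup_eq_top_of_symPowIdeal p e _ ?_ fun s => ?_
  · rintro s _ ⟨y, rfl⟩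
    exact ⟨s • y, frobeniusTensorMap_smul p e σ s y⟩
  · refine ⟨σ (Ideal.Quotient.mk _ s), ⟨1 ⊗ₜ (FrobeniusPushforward.addEquiv k p e _).symm
      (Ideal.Quotient.mk _ s), ?_⟩, hd s, hσ _⟩
    rw [frobeniusTensorMap_tmul, one_pow, one_mul, AddEquiv.apply_symm_apply]

/-- The Frobenius pushforward of `Sym V` is free on bounded monomials. -/
theorem exists_basis_frobeniusPushforward [PerfectField k] (p : ℕ) [ExpChar k p]
    [ExpChar (SymmetricAlgebra k V) p]
    (e : ℕ) : Nonempty (((Fin (Module.finrank k V) → Fin (p ^ e)) → SymmetricAlgebra k V)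
      ≃ₗ[SymmetricAlgebra k V] FrobeniusPushforward (SymmetricAlgebra k V) p e
        (SymmetricAlgebra k V)) := by
  let A := FrobeniusPushforward.addEquiv (SymmetricAlgebra k V) p e (SymmetricAlgebra k V)
  let x : (Fin (Module.finrank k V) → Fin (p ^ e)) → SymmetricAlgebra k V := fun b =>
    (symCoord k V).symm (MvPolynomial.monomial (MvPolynomial.boundedExp b) 1)
  let F : ((Fin (Module.finrank k V) → Fin (p ^ e)) → SymmetricAlgebra k V)
      →ₗ[SymmetricAlgebra k V] FrobeniusPushforward (SymmetricAlgebra k V) p e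
        (SymmetricAlgebra k V) :=
    Fintype.linearCombination (SymmetricAlgebra k V) fun b => A.symm (x b)
  have hF : ∀ c, A (F c) = ∑ b, c b ^ p ^ e * x b := by
    intro c
    simp only [F, Fintype.linearCombination_apply, map_sum]
    refine Finset.sum_congr rfl fun b _ => ?_
    rw [FrobeniusPushforward.addEquiv_smul, AddEquiv.apply_symm_apply, smul_eq_mul]
  refine ⟨LinearEquiv.ofBijective F ⟨?_, ?_⟩⟩
  · rw [injective_iff_map_eq_zero]
    intro c hc
    have h1 : ∑ b, c b ^ p ^ e * x b = 0 := by rw [← hF, hc, map_zero]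
    have h2 := congrArg (symCoord k V) h1
    simp only [map_sum, map_mul, map_pow, x, AlgEquiv.apply_symm_apply, map_zero] at h2
    have h3 := MvPolynomial.sum_pow_mul_monomial_injective (fun b => symCoord k V (c b)) h2
    funext b
    have := congrFun h3 b
    simpa using this
  · have h1 : ((A : _ →+ SymmetricAlgebra k V).comp F.toAddMonoidHom).range = ⊤ := by
      refine addSubgroup_eq_top_of_symPowIdeal p e _ ?_ fun s => ?_
      · rintro s _ ⟨c, rfl⟩
        refine ⟨s • c, ?_⟩
        change A (F (s • c)) = _ * A (F c)
        rw [map_smul, FrobeniusPushforward.addEquiv_smul, smul_eq_mul]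
      · have : PerfectRing k p := PerfectField.toPerfectRing p
        -- In the pushforward scalars enter as q-th powers; perfectness supplies q-th roots of the
        -- required coefficients.
        choose r hr using fun b => (bijective_iterateFrobenius k p e).2
          (MvPolynomial.boundedCoeff k (fun _ => p ^ e) (symCoord k V s) b)
        refine ⟨(symCoord k V).symm (MvPolynomial.boundedPoly k _
          (MvPolynomial.boundedCoeff k (fun _ => p ^ e) (symCoord k V s))),
          ⟨fun b => algebraMap k _ (r b), ?_⟩, ?_, (symPowQuotientEquiv k V p e).symm_apply_apply
            (Ideal.Quotient.mk _ s)⟩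
        · change A (F _) = _
          rw [hF, MvPolynomial.boundedPoly_apply, map_sum]
          refine Finset.sum_congr rfl fun b _ => ?_
          rw [← hr b, iterateFrobenius_def, ← map_pow, ← Algebra.smul_def, ← map_smul,
            MvPolynomial.smul_monomial, smul_eq_mul, mul_one]
        · rw [AlgEquiv.apply_symm_apply]
          exact MvPolynomial.totalDegree_boundedPoly_boundedCoeff_le _ _
    intro y
    obtain ⟨c, hc⟩ : A y ∈ ((A : _ →+ SymmetricAlgebra k V).comp F.toAddMonoidHom).range :=
      h1 ▸ AddSubgroup.mem_top _
    exact ⟨c, A.injective hc⟩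

theorem frobeniusTensorMap_bijective [PerfectField k] (p : ℕ) [ExpChar k p] (e : ℕ)
    (σ : (SymmetricAlgebra k V ⧸ symPowIdeal k V (p ^ e)) →ₗ[k] SymmetricAlgebra k V)
    (hσ : ∀ t, Ideal.Quotient.mk _ (σ t) = t)
    (hd : ∀ s, (symCoord k V (σ (Ideal.Quotient.mk _ s))).totalDegree ≤
      (symCoord k V s).totalDegree) : Function.Bijective (frobeniusTensorMap p e σ) := by
  have hsurj := frobeniusTensorMap_surjective p e σ hσ hd
  refine ⟨?_, hsurj⟩
  have := expChar_of_injective_algebraMap (algebraMap k (SymmetricAlgebra k V)).injective p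
  let T := FrobeniusPushforward k p e (SymmetricAlgebra k V ⧸ symPowIdeal k V (p ^ e))
  let A := FrobeniusPushforward.addEquiv (SymmetricAlgebra k V) p e (SymmetricAlgebra k V)
  obtain ⟨Θ⟩ := exists_basis_frobeniusPushforward (k := k) (V := V) p e
  have hfd : FiniteDimensional k T := FrobeniusPushforward.finiteDimensional k p e _
  have hcard : Module.finrank k T =
      Fintype.card (Fin (Module.finrank k V) → Fin (p ^ e)) := by
    rw [FrobeniusPushforward.finrank_eq k p e (FrobeniusPushforward.addEquiv k p e _)
      (FrobeniusPushforward.addEquiv_smul k p e _), finrank_symPowQuotient]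
    rw [Fintype.card_fun, Fintype.card_fin, Fintype.card_fin, ← pow_mul, mul_comm]
  let b : Module.Basis (Fin (Module.finrank k V) → Fin (p ^ e)) k T :=
    (Module.finBasis k T).reindex (Fintype.equivOfCardEq (by rw [Fintype.card_fin, hcard]))
  let B := Algebra.TensorProduct.basis (SymmetricAlgebra k V) b
  let Φ : SymmetricAlgebra k V ⊗[k] T →ₗ[SymmetricAlgebra k V]
      FrobeniusPushforward (SymmetricAlgebra k V) p e (SymmetricAlgebra k V) :=
    { toFun := fun y => A.symm (frobeniusTensorMap p e σ y)
      map_add' := fun x y => by rw [map_add, map_add]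
      map_smul' := fun s y => frobeniusTensorMap_smul p e σ s y }
  -- Source and target are free of the same rank q^d, so surjectivity implies injectivity by the
  -- Orzech property.
  have hΦ : Function.Surjective (Θ.symm.toLinearMap ∘ₗ Φ ∘ₗ B.equivFun.symm.toLinearMap) :=
    Θ.symm.surjective.comp ((A.symm.surjective.comp hsurj).comp B.equivFun.symm.surjective)
  have hinj := OrzechProperty.injective_of_surjective_endomorphism _ hΦ
  intro y z hyz
  refine B.equivFun.injective (hinj ?_)
  simp only [LinearMap.comp_apply, LinearEquiv.coe_coe, LinearEquiv.symm_apply_apply]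
  exact congrArg (fun w => Θ.symm (A.symm w)) hyz

/-- The Frobenius pushforward of the invariant ring is a module of covariants. -/
theorem nonempty_frobeniusPushforward_equiv_covariantModule [PerfectField k]
    (G : Subgroup (LinearMap.GeneralLinearGroup k V)) [Finite G] [NeZero (Nat.card G : k)]
    (p : ℕ) [ExpChar k p] (e : ℕ) :
    Nonempty (FrobeniusPushforward (invariantRing G) p e (invariantRing G) ≃ₗ[invariantRing G]
      covariantModule G ((symPowRep G (p ^ e)).frobeniusTwist p e)) := by
  obtain ⟨σ, hσ, hσg, hd⟩ := exists_equivariant_section G p e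
  have hbij := frobeniusTensorMap_bijective p e σ hσ hd
  have hg := frobeniusTensorMap_tprod G p e (symPowRep G (p ^ e)) σ hσg
  let A := FrobeniusPushforward.addEquiv (invariantRing G) p e (invariantRing G)
  let Ψ : covariantModule G ((symPowRep G (p ^ e)).frobeniusTwist p e) →ₗ[invariantRing G]
      FrobeniusPushforward (invariantRing G) p e (invariantRing G) :=
    { toFun := fun y => A.symm ⟨frobeniusTensorMap p e σ y, fun g => by
        rw [← symAction_smul_def, ← hg, (mem_covariantModule G).mp y.2 g]⟩
      map_add' := fun x y => congrArg A.symm (Subtype.ext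
        ((frobeniusTensorMap p e σ).map_add (x : SymmetricAlgebra k V ⊗[k] _) y))
      map_smul' := fun r y => congrArg A.symm (Subtype.ext
        (frobeniusTensorMap_smul p e σ (r : SymmetricAlgebra k V) y)) }
  refine ⟨(LinearEquiv.ofBijective Ψ ⟨fun x y hxy => ?_, fun r => ?_⟩).symm⟩
  · exact Subtype.ext (hbij.1 (congrArg Subtype.val (A.symm.injective hxy)))
  · obtain ⟨y, hy⟩ := hbij.2 (A r : SymmetricAlgebra k V)
    refine ⟨⟨y, fun g => hbij.1 ?_⟩, A.injective (Subtype.ext hy)⟩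
    rw [hg, hy]
    exact (A r).2 g

end FrobeniusStructure


/-! ### Multiplicity against dimension -/

/-- A linear map whose kernel consists of maps with values in `K` has small kernel. -/
theorem LinearMap.finrank_le_add_of_ker_le {k A B W T : Type*} [Field k] [AddCommGroup A]
    [Module k A] [AddCommGroup B] [Module k B] [AddCommGroup W] [Module k W] [AddCommGroup T]
    [Module k T] [FiniteDimensional k A] [FiniteDimensional k B] [FiniteDimensional k W]
    [FiniteDimensional k T] (f : A →ₗ[k] B) (j : A →ₗ[k] W →ₗ[k] T)
    (hj : Function.Injective j) (K : Submodule k T) (hK : ∀ a, f a = 0 → ∀ w, j a w ∈ K) :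
    Module.finrank k A ≤ Module.finrank k B + Module.finrank k W * Module.finrank k K := by
  let F : LinearMap.ker f →ₗ[k] W →ₗ[k] K :=
    { toFun := fun a => (j a).codRestrict K (hK a a.2)
      map_add' := fun a b => by ext; simp
      map_smul' := fun r a => by ext; simp }
  have hF : Function.Injective F := fun a b hab => Subtype.ext (hj (LinearMap.ext fun w =>
    congrArg Subtype.val (LinearMap.congr_fun hab w)))
  have h1 := LinearMap.finrank_le_finrank_of_injective hF
  rw [Module.finrank_linearMap] at h1
  have h2 := f.finrank_range_add_finrank_ker
  have h3 := Submodule.finrank_le (LinearMap.range f)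
  omega

section Multiplicity

variable {k G S T W : Type*} [Field k] [Group G] [Fintype G] [DecidableEq G] [CommRing S]
  [MulSemiringAction G S] [AddCommGroup T] [Module k T] [FiniteDimensional k T] [Module S T]
  [SMulCommClass S k T] [AddCommGroup W] [Module k W] [FiniteDimensional k W]

/-- The multiplicity of `κ` in `τ` is at most the expected one, up to the kernel of
multiplication by the orbit determinant. -/
theorem finrank_intertwiningMap_le (τ : Representation k G T)
    (hτ : ∀ (g : G) (s : S) (t : T), τ g (s • t) = (g • s) • τ g t)
    (κ : Representation k G W) (s : S) (K : Submodule k T)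
    (hK : ∀ t, (orbitMatrix G s).det • t = 0 → t ∈ K) :
    Module.finrank k (IntertwiningMap κ τ) ≤
      Module.finrank k W * Module.finrank k τ.invariants +
        Module.finrank k W * Module.finrank k K := by
  let m : T →ₗ[k] T := DistribSMul.toLinearMap k T s
  let tr : T →ₗ[k] τ.invariants := LinearMap.codRestrict τ.invariants (∑ h, τ h ∘ₗ m)
    fun t g => by
      simp only [LinearMap.sum_apply, map_sum, LinearMap.comp_apply]
      exact Fintype.sum_equiv (Equiv.mulLeft g) _ _ fun h => by simp
  -- Sends `φ` to w ↦ Σ h(s φ(w)), the trace weighted by `s`.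
  let f : IntertwiningMap κ τ →ₗ[k] W →ₗ[k] τ.invariants :=
    tr.compRight k ∘ₗ IntertwiningMap.toLinearMapl κ τ
  rw [← Module.finrank_linearMap]
  refine LinearMap.finrank_le_add_of_ker_le f (IntertwiningMap.toLinearMapl κ τ)
    (IntertwiningMap.toLinearMap_injective κ τ) K fun φ hφ w => hK _ ?_
  have h1 : ∀ x, ∑ h, τ h (s • φ x) = 0 := fun x => by
    have := congrArg Subtype.val (LinearMap.congr_fun hφ x)
    simpa [f, tr, m] using! this
  -- Equivariance of `φ` turns the vanishing at the translates `κ g w` into a square linear system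
  -- in the vectors `τ h (φ w)`, ready for Cramer's rule.
  have h2 : ∀ g : G, ∑ h, (orbitMatrix G s).transpose g h • τ h (φ w) = 0 := by
    intro g
    rw [← h1 (κ g w)]
    refine (Fintype.sum_equiv (Equiv.mulRight g) _ _ fun h => ?_).symm
    rw [Equiv.coe_mulRight, hτ, φ.isIntertwining, map_mul, Module.End.mul_apply]
    simp [orbitMatrix]
  have h3 := Matrix.det_smul_eq_zero_of_sum_smul_eq_zero _ (fun h => τ h (φ w)) h2 1
  rw [Matrix.det_transpose] at h3
  simpa using h3

/-- The multiplicity of `κ` in `τ` is at least the expected one, up to the kernel of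
multiplication by the orbit determinant. -/
theorem le_finrank_intertwiningMap (τ : Representation k G T)
    (hτ : ∀ (g : G) (s : S) (t : T), τ g (s • t) = (g • s) • τ g t)
    (κ : Representation k G W) (s : S) (K : Submodule k T)
    (hK : ∀ t, (orbitMatrix G s).det • t = 0 → t ∈ K) :
    Module.finrank k W * Module.finrank k τ.invariants ≤
      Module.finrank k (IntertwiningMap κ τ) +
        Module.finrank k W * Module.finrank k K := by
  let m (g : G) : T →ₗ[k] T := DistribSMul.toLinearMap k T (g • s)
  -- Sends `β` to the sum of the conjugates of w ↦ s β(w), using that `β` has invariant values.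
  let f : (W →ₗ[k] τ.invariants) →ₗ[k] IntertwiningMap κ τ :=
    { toFun := fun β => ⟨∑ g, m g ∘ₗ τ.invariants.subtype ∘ₗ β ∘ₗ κ g⁻¹, fun h =>
        LinearMap.ext fun w => by
          simp only [LinearMap.sum_apply, LinearMap.comp_apply, map_sum]
          refine (Fintype.sum_equiv (Equiv.mulLeft h) _ _ fun g => ?_).symm
          simp only [m, Equiv.coe_mulLeft, DistribSMul.toLinearMap_apply, hτ, mul_inv_rev, map_mul,
            Module.End.mul_apply, Submodule.subtype_apply, smul_smul]
          rw [(β _).2 h, ← Module.End.mul_apply (κ h⁻¹), ← map_mul, inv_mul_cancel, map_one,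
            Module.End.one_apply]⟩
      map_add' := fun β γ => IntertwiningMap.ext (LinearMap.ext fun w => by
        simp [Finset.sum_add_distrib])
      map_smul' := fun a β => IntertwiningMap.ext (LinearMap.ext fun w => by
        simp [Finset.smul_sum]) }
  rw [← Module.finrank_linearMap (R := k) (S := k) (M := W) (N := τ.invariants)]
  refine LinearMap.finrank_le_add_of_ker_le f (τ.invariants.subtype.compRight k)
    (fun β γ h => LinearMap.ext fun w => Subtype.ext (LinearMap.congr_fun h w)) K
    fun β hβ w => hK _ ?_
  have h1 : ∀ x, ∑ g, (g • s) • (β (κ g⁻¹ x) : T) = 0 := fun x => by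
    have := LinearMap.congr_fun (congrArg IntertwiningMap.toLinearMap hβ) x
    simpa [f, m] using! this
  have h2 : ∀ g : G, ∑ h, orbitMatrix G s g h • (β (κ h w) : T) = 0 := by
    intro g
    rw [← h1 (κ g w)]
    refine Fintype.sum_equiv ((Equiv.inv G).trans (Equiv.mulLeft g)) _ _ fun h => ?_
    simp only [Equiv.trans_apply, Equiv.inv_apply, Equiv.coe_mulLeft, orbitMatrix, Matrix.of_apply,
      mul_inv_rev, inv_inv, map_mul, Module.End.mul_apply]
    rw [← Module.End.mul_apply (κ g⁻¹), ← map_mul, inv_mul_cancel, map_one,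
            Module.End.one_apply]
  have h3 := Matrix.det_smul_eq_zero_of_sum_smul_eq_zero _ (fun h => (β (κ h w) : T)) h2 1
  simpa using h3

/-- Comparison of the multiplicity of `κ` with its share in the dimension. -/
theorem abs_finrank_intertwiningMap_sub_le (τ : Representation k G T)
    (hτ : ∀ (g : G) (s : S) (t : T), τ g (s • t) = (g • s) • τ g t)
    (κ : Representation k G W) (s : S) (K : Submodule k T)
    (hK : ∀ t, (orbitMatrix G s).det • t = 0 → t ∈ K) :
    |(Module.finrank k (IntertwiningMap κ τ) : ℝ) -
      Module.finrank k W / Nat.card G * Module.finrank k T| ≤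
        2 * Module.finrank k W * Module.finrank k K := by
  have a1 := finrank_intertwiningMap_le τ hτ κ s K hK
  have a2 := le_finrank_intertwiningMap τ hτ κ s K hK
  -- For the regular representation the multiplicity space is `T` itself, so these bounds compare
  -- dim T with |G| · dim T^G and eliminate the unknown dimension of the invariants.
  have b1 := finrank_intertwiningMap_le τ hτ (leftRegular k G) s K hK
  have b2 := le_finrank_intertwiningMap τ hτ (leftRegular k G) s K hK
  have hc : Module.finrank k (MonoidAlgebra k G) = Nat.card G := by
    rw [(MonoidAlgebra.coeffLinearEquiv k).finrank_eq, Module.finrank_finsupp_self,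
      Nat.card_eq_fintype_card]
  rw [(leftRegularMapEquiv τ).finrank_eq, hc] at b1 b2
  have hG : (0 : ℝ) < Nat.card G := by exact_mod_cast Nat.card_pos
  set c := Module.finrank k (IntertwiningMap κ τ)
  set w := Module.finrank k W
  set N := Module.finrank k τ.invariants
  set ε := Module.finrank k K
  set D := Module.finrank k T
  set n := Nat.card G
  have a1' : (c : ℝ) ≤ w * N + w * ε := by exact_mod_cast a1
  have a2' : (w : ℝ) * N ≤ c + w * ε := by exact_mod_cast a2
  have b1' : (D : ℝ) ≤ n * N + n * ε := by exact_mod_cast b1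
  have b2' : (n : ℝ) * N ≤ D + n * ε := by exact_mod_cast b2
  have c1 : |(D : ℝ) / n - N| ≤ ε := by
    rw [abs_le]
    constructor
    · rw [neg_le_sub_iff_le_add, ← sub_le_iff_le_add, le_div_iff₀ hG]
      linarith
    · rw [sub_le_iff_le_add, div_le_iff₀ hG]
      linarith
  have c2 : |(c : ℝ) - w * N| ≤ w * ε := by
    rw [abs_le]
    constructor <;> linarith
  have c3 : (c : ℝ) - w / n * D = (c - w * N) - w * (D / n - N) := by ring
  rw [c3]
  refine (abs_sub _ _).trans ?_
  rw [abs_mul, abs_of_nonneg (Nat.cast_nonneg w : (0 : ℝ) ≤ w)]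
  have := mul_le_mul_of_nonneg_left c1 (Nat.cast_nonneg w : (0 : ℝ) ≤ w)
  linarith

end Multiplicity


/-! ### Passage to the limit -/

theorem tendsto_pow_sub_div_pow {p : ℕ} (hp : 1 < p) (a : ℕ) :
    Tendsto (fun e => ((p ^ e - a : ℕ) : ℝ) / (p : ℝ) ^ e) atTop (nhds 1) := by
  have hp' : (1 : ℝ) < p := by exact_mod_cast hp
  have h1 : Tendsto (fun e => 1 - (a : ℝ) / (p : ℝ) ^ e) atTop (nhds (1 - 0)) :=
    tendsto_const_nhds.sub (tendsto_const_nhds.div_atTop (tendsto_pow_atTop_atTop_of_one_lt hp'))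
  rw [sub_zero] at h1
  refine h1.congr' ?_
  filter_upwards [(tendsto_pow_atTop_atTop_of_one_lt hp).eventually_ge_atTop a] with e he
  have : (p : ℝ) ^ e ≠ 0 := by positivity
  rw [Nat.cast_sub he, Nat.cast_pow, sub_div, div_self this]

/-- A sequence whose distance to `r q^d`, `q = p^e`, is controlled by `q^d - ∏ (q - a i)` grows
like `r q^d`. -/
theorem tendsto_div_pow_of_abs_sub_le {p d : ℕ} (hp : 1 < p) (a : Fin d → ℕ) (c ε : ℕ → ℕ)
    (r C : ℝ) (hC : 0 ≤ C) (hc : ∀ e, |(c e : ℝ) - r * (p ^ (d * e) : ℕ)| ≤ C * ε e)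
    (hε : ∀ e, ε e + ∏ i, (p ^ e - a i) ≤ p ^ (d * e)) :
    Tendsto (fun e => (c e : ℝ) / (p : ℝ) ^ (d * e)) atTop (nhds r) := by
  have hp' : (1 : ℝ) < p := by exact_mod_cast hp
  have h1 : Tendsto (fun e => ∏ i : Fin d, ((p ^ e - a i : ℕ) : ℝ) / (p : ℝ) ^ e) atTop
      (nhds 1) := by
    have := tendsto_finsetProd (Finset.univ : Finset (Fin d))
      fun i _ => tendsto_pow_sub_div_pow hp (a i)
    simpa using this
  have h2 : Tendsto (fun e => C * (1 - ∏ i : Fin d, ((p ^ e - a i : ℕ) : ℝ) / (p : ℝ) ^ e)) atTop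
      (nhds 0) := by
    simpa only [sub_self, mul_zero] using ((tendsto_const_nhds (x := (1 : ℝ))).sub h1).const_mul C
  rw [tendsto_iff_dist_tendsto_zero]
  refine squeeze_zero (fun _ => dist_nonneg) (fun e => ?_) h2
  have hq : (0 : ℝ) < (p : ℝ) ^ (d * e) := by positivity
  have h3 : ∏ i : Fin d, ((p ^ e - a i : ℕ) : ℝ) / (p : ℝ) ^ e =
      (∏ i : Fin d, (p ^ e - a i) : ℕ) / (p : ℝ) ^ (d * e) := by
    rw [Finset.prod_div_distrib, Finset.prod_const, Finset.card_univ, Fintype.card_fin, ← pow_mul,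
      mul_comm e d, Nat.cast_prod]
  have h4 := hc e
  have h5 : (ε e : ℝ) + (∏ i : Fin d, (p ^ e - a i) : ℕ) ≤ (p : ℝ) ^ (d * e) := by
    exact_mod_cast hε e
  rw [Nat.cast_pow] at h4
  rw [h3, Real.dist_eq]
  have h6 : (c e : ℝ) / (p : ℝ) ^ (d * e) - r = (c e - r * (p : ℝ) ^ (d * e)) /
      (p : ℝ) ^ (d * e) := by
    field_simp
  rw [h6, abs_div, abs_of_pos hq, div_le_iff₀ hq]
  have h7 : C * (1 - (∏ i : Fin d, (p ^ e - a i) : ℕ) / (p : ℝ) ^ (d * e)) * (p : ℝ) ^ (d * e) =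
      C * ((p : ℝ) ^ (d * e) - (∏ i : Fin d, (p ^ e - a i) : ℕ)) := by
    field_simp
  rw [h7]
  exact h4.trans (mul_le_mul_of_nonneg_left (by linarith) hC)

/-- Scalars acting on the underlying module of a Frobenius pushforward without a twist. -/
abbrev FrobeniusPushforward.moduleOfUntwisted (A : Type u) (p e : ℕ) (M : Type v) [CommRing A]
    [AddCommGroup M] [Module A M] (S : Type w) [Ring S] [Module S M] :
    Module S (FrobeniusPushforward A p e M) :=
  inferInstanceAs (Module S M)

section Asymptotics

variable {k : Type u} {V : Type v} [Field k] [AddCommGroup V] [Module k V]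
  [FiniteDimensional k V] (G : Subgroup (LinearMap.GeneralLinearGroup k V))

/-- The multiplicities in the Frobenius twists of `Sym V` modulo `q`-th powers approach the
multiplicities in the regular representation. -/
theorem tendsto_finrank_intertwiningMap_symPowRep [Infinite k] [PerfectField k] [Finite G]
    (p : ℕ) [ExpChar k p] (hp : 1 < p) {W : Type*} [AddCommGroup W] [Module k W]
    [FiniteDimensional k W] (κ : Representation k G W) :
    Tendsto (fun e => (Module.finrank k (IntertwiningMap κ
      ((symPowRep G (p ^ e)).frobeniusTwist p e)) : ℝ) / (p : ℝ) ^ (Module.finrank k V * e))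
      atTop (nhds ((Module.finrank k W : ℝ) / Nat.card G)) := by
  classical
  have := Fintype.ofFinite G
  obtain ⟨s, hs⟩ := exists_symmetricAlgebra_det_orbitMatrix_ne_zero G
  obtain ⟨a, ha⟩ := exists_finrank_ker_symPowQuotient_le p hs
  refine tendsto_div_pow_of_abs_sub_le hp a _ _ _ (2 * Module.finrank k W) (by positivity)
    (fun e => ?_) ha
  let Q := SymmetricAlgebra k V ⧸ symPowIdeal k V (p ^ e)
  let T := FrobeniusPushforward k p e Q
  let A : T ≃+ Q := FrobeniusPushforward.addEquiv k p e Q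
  have hA : ∀ (b : k) (t : T), A (b • t) = b ^ p ^ e • A t :=
    FrobeniusPushforward.addEquiv_smul k p e Q
  have : FiniteDimensional k T := FrobeniusPushforward.finiteDimensional k p e Q
  -- Only the scalars `k` are twisted: `S` acts on `T` as on the quotient, so multiplication by `f`
  -- and its kernel are unchanged, and the two actions commute.
  let _ : Module (SymmetricAlgebra k V) T := FrobeniusPushforward.moduleOfUntwisted k p e Q _
  have hAS : ∀ (x : SymmetricAlgebra k V) (t : T), A (x • t) = x • A t := fun _ _ => rfl
  have : SMulCommClass (SymmetricAlgebra k V) k T := ⟨fun x b t => A.injective (by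
    rw [hAS, hA, hA, hAS, smul_comm])⟩
  let f := (orbitMatrix G s).det
  let K : Submodule k T := LinearMap.ker (DistribSMul.toLinearMap k T f)
  let j : K ≃+ LinearMap.ker (Algebra.lsmul k k Q f) :=
    { toFun := fun t => ⟨A t, t.2⟩
      invFun := fun t => ⟨A.symm t, t.2⟩
      left_inv := fun _ => rfl
      right_inv := fun _ => rfl
      map_add' := fun _ _ => rfl }
  have hK : Module.finrank k K = Module.finrank k (LinearMap.ker (Algebra.lsmul k k Q f)) :=
    FrobeniusPushforward.finrank_eq k p e j fun _ _ => rfl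
  have hT : Module.finrank k T = p ^ (Module.finrank k V * e) := by
    rw [FrobeniusPushforward.finrank_eq k p e A hA, finrank_symPowQuotient]
  have h := abs_finrank_intertwiningMap_sub_le (S := SymmetricAlgebra k V)
    ((symPowRep G (p ^ e)).frobeniusTwist p e)
    (fun g x t => symPowRep_smul G (p ^ e) g x (A t)) κ s K (fun t ht => ht)
  rw [hT, hK] at h
  exact h

end Asymptotics

end

theorem mainTheorem1 {k : Type u} [Field k] [IsAlgClosed k] (p : ℕ) [Fact p.Prime] [CharP k p]
    {V : Type v} [AddCommGroup V] [Module k V] [FiniteDimensional k V]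
    (G : Subgroup (LinearMap.GeneralLinearGroup k V)) [Finite G]
    (hp : ¬ p ∣ Nat.card G) (hG : NoPseudoReflections G)
    {n : ℕ} {W : Fin (n + 1) → Type w} [∀ i, AddCommGroup (W i)] [∀ i, Module k (W i)]
    (ρ : ∀ i, Representation k G (W i)) (hρ : IsCompleteIrreducibles ρ)
    (h0 : Nonempty ((ρ 0).Equiv (Representation.trivial k G k))) (i : Fin (n + 1)) :
    IsGeneralizedFSignature G p ρ i ((Module.finrank k (W i) : ℝ) / Nat.card G) ∧
    (Module.finrank k (W i) : ℝ) / Nat.card G =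
      (Module.finrank (invariantRing G) (covariantModule G (ρ i)) : ℝ) / Nat.card G := by
  have := (hρ.irreducible i).finiteDimensional
  have : NeZero (Nat.card G : k) := ⟨fun h => hp ((CharP.cast_eq_zero_iff k p _).mp h)⟩
  have hp1 : 1 < p := (Fact.out : p.Prime).one_lt
  -- The multiplicities are c_{j,e} = dim Hom_G(W_j, T_e).
  refine ⟨⟨fun e j => Module.finrank k (Representation.IntertwiningMap (ρ j)
    ((symPowRep G (p ^ e)).frobeniusTwist p e)), fun e c => ?_,
    tendsto_finrank_intertwiningMap_symPowRep G p hp1 (ρ i)⟩, ?_⟩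
  · have := FrobeniusPushforward.finiteDimensional k p e
      (SymmetricAlgebra k V ⧸ symPowIdeal k V (p ^ e))
    obtain ⟨Ψ⟩ := nonempty_frobeniusPushforward_equiv_covariantModule G p e
    exact isFrobeniusDecomposition_iff p hG hρ e _ Ψ c
  · rw [finrank_covariantModule (ρ i) hG]
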